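/- **Definitions.** A measurable space is *Borel* if it is isomorphic to a Borel subset of a Polish space with its Borel $\sigma$-algebra. A *graphon* $(W,S,\mu)$ is a symmetric function $W:S\times S\to\mathbb R$ that is integrable with respect to $\mu\times\mu$, where $(S,\mu)$ is a $\sigma$-finite measure space (neither boundedness nor non-negativity is required). A *trivial extension* of $(W,S,\mu)$ is a graphon $(\widetilde W,\widetilde S,\widetilde\mu)$ such that the measure space $(S,\mu)$ is (up to isomorphism) a measurable subset of $\widetilde S$ with the restricted $\sigma$-algebra and measure, $\widetilde W=W$ on $S\times S$, and $\widetilde W=0$ on $(\widetilde S\times\widetilde S)\setminus (S\times S)$. A *coupling* of $(S_1,\mu_1)$ and $(S_2,\mu_2)$ is a pair $(\varphi_1,\varphi_2)$ of measure-preserving maps $\varphi_i:(S,\mu)\to(S_i,\mu_i)$ on a common measure space $(S,\mu)$; it is *special* if $S=S_1\times S_2$ and $\varphi_1,\varphi_2$ are the two coordinate projections. For $\varphi:S\to S'$ and $W:S'\times S'\to\mathbb R$ put $W^{\varphi}(x,y):=W(\varphi(x),\varphi(y))$. The *cut norm* of $F\in L^1(S\times S,\mu\times\mu)$ is $$\|F\|_{\square,\mu}:=\sup_{A,B}\Bigl|\int_{A\times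 B}F\,d(\mu\times\mu)\Bigr|,$$ the supremum being over all measurable $A,B\subseteq S$. For graphons $(W_1,S_1,\mu_1)$ and $(W_2,S_2,\mu_2)$ with $\mu_1(S_1)=\mu_2(S_2)$, the *cut distance* is $$\delta_\square(W_1,W_2):=\inf\|W_1^{\varphi_1}-W_2^{\varphi_2}\|_{\square,\mu},$$ the infimum being over all special couplings. If $\mu_1(S_1)\ne\mu_2(S_2)$, then $\delta_\square(W_1,W_2):=\delta_\square(\widetilde W_1,\widetilde W_2)$, where $\widetilde W_1,\widetilde W_2$ are trivial extensions to spaces of equal total mass (the value does not depend on which ones; for definiteness, adjoin to both $S_1$ and $S_2$ a disjoint copy of $\mathbb R$ with Lebesgue measure). **Theorem 5.3.** Let $(W_1,S_1,\mu_1)$ and $(W_2,S_2,\mu_2)$ be graphons on $\sigma$-finite Borel measure spaces with $\delta_\square(W_1,W_2)=0$. Then there exist trivial extensions $(\widetilde W_i,\widetilde S_i,\widetilde\mu_i)$ of $(W_i,S_i,\mu_i)$, $i=1,2$, and a coupling $(\varphi_1,\varphi_2)$ of $(\widetilde S_1,\widetilde\mu_1)$ and $(\widetilde S_2,\widetilde\mu_2)$,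 defined on a measure space $(S,\mu)$, such that $\widetilde W_1^{\varphi_1}=\widetilde W_2^{\varphi_2}$ $(\mu\times\mu)$-a.e. Moreover, the coupling can be taken to be special. -/

import Mathlib

open MeasureTheory
open scoped ENNReal

universe u v

noncomputable section

namespace SigmaFiniteGraphon

/-- `W` is a graphon on the measure space `(S, μ)`: the measure is `σ`-finite, and
`W : S × S → ℝ` (written in curried form) is symmetric and integrable for `μ × μ`. -/
structure IsGraphon {S : Type*} [MeasurableSpace S] (μ : Measure S) (W : S → S → ℝ) : Prop where
  sigmaFinite : SigmaFinite μ
  symm : ∀ x y, W x y = W y x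
  integrable : Integrable (fun z : S × S => W z.1 z.2) (μ.prod μ)

/-- `(V, T, ν)` is a trivial extension of the graphon `(W, S, μ)`, where `ι : S → T` is the
inclusion: `(V, T, ν)` is a graphon, `ι` identifies the measure space `(S, μ)` with a subspace of
`(T, ν)` (a measurable subset with the trace `σ`-algebra and the restricted measure), and `V` is
`W` on this subspace and is zero at all other pairs of points. -/
structure IsTrivialExtension {S T : Type*} [MeasurableSpace S] [MeasurableSpace T]
    (μ : Measure S) (W : S → S → ℝ) (ν : Measure T) (V : T → T → ℝ) (ι : S → T) : Prop where
  isGraphon : IsGraphon ν V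
  measurableEmbedding : MeasurableEmbedding ι
  comap_eq : ν.comap ι = μ
  apply_apply : ∀ x y, V (ι x) (ι y) = W x y
  eq_zero : ∀ a b, (a ∉ Set.range ι ∨ b ∉ Set.range ι) → V a b = 0

/-- The pull-back `W^φ (x, y) = W (φ x, φ y)`. -/
def pullback {S T : Type*} (φ : S → T) (W : T → T → ℝ) : S → S → ℝ :=
  fun x y => W (φ x) (φ y)

/-- The cut norm `sup_{A, B} |∫_{A × B} F d(μ × μ)|`, the supremum being over all measurable
`A, B ⊆ S`, as an element of `[0, ∞]`. -/
def cutNorm {S : Type*} [MeasurableSpace S] (μ : Measure S) (F : S → S → ℝ) : ℝ≥0∞ :=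
  ⨆ (A : Set S) (_ : MeasurableSet A) (B : Set S) (_ : MeasurableSet B),
    ‖∫ z in A ×ˢ B, F z.1 z.2 ∂(μ.prod μ)‖ₑ

/-- `(φ₁, φ₂)` is a coupling of `(S₁, μ₁)` and `(S₂, μ₂)`: a pair of measure-preserving maps
`φᵢ : S → Sᵢ` on a common measure space `(S, μ)`. The coupling is special if `S = S₁ × S₂` and
`φ₁, φ₂` are the projections `Prod.fst, Prod.snd`; then `μ` is called a coupling measure. -/
structure IsCoupling {S S₁ S₂ : Type*} [MeasurableSpace S] [MeasurableSpace S₁]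
    [MeasurableSpace S₂] (μ : Measure S) (μ₁ : Measure S₁) (μ₂ : Measure S₂)
    (φ₁ : S → S₁) (φ₂ : S → S₂) : Prop where
  fst : MeasurePreserving φ₁ μ μ₁
  snd : MeasurePreserving φ₂ μ μ₂

/-- The infimum of `‖W₁^{π₁} - W₂^{π₂}‖_□` over all special couplings of `(S₁, μ₁)` and `(S₂, μ₂)`.
This is the cut distance if `μ₁ (S₁) = μ₂ (S₂)`. -/
def couplingCutDist {S₁ S₂ : Type*} [MeasurableSpace S₁] [MeasurableSpace S₂]
    (μ₁ : Measure S₁) (μ₂ : Measure S₂) (W₁ : S₁ → S₁ → ℝ) (W₂ : S₂ → S₂ → ℝ) : ℝ≥0∞ :=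
  ⨅ (μ : Measure (S₁ × S₂)) (_ : IsCoupling μ μ₁ μ₂ Prod.fst Prod.snd),
    cutNorm μ (pullback Prod.fst W₁ - pullback Prod.snd W₂)

/-- The measure on the disjoint union `S ⊔ ℝ` which is `μ` on `S` and Lebesgue measure on `ℝ`.
Its total mass is infinite. -/
def extMeasure {S : Type*} [MeasurableSpace S] (μ : Measure S) : Measure (S ⊕ ℝ) :=
  μ.map Sum.inl + (volume : Measure ℝ).map Sum.inr

/-- The extension by zero of `W` to `S ⊔ ℝ`. -/
def extFun {S : Type*} (W : S → S → ℝ) : S ⊕ ℝ → S ⊕ ℝ → ℝ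
  | Sum.inl x, Sum.inl y => W x y
  | _, _ => 0

open Classical in
/-- The cut distance `δ_□ (W₁, W₂)`. If the two underlying spaces have the same total mass, it is the
infimum over couplings. Otherwise it is the same infimum for trivial extensions to spaces of equal
total mass; the value does not depend on these, and we adjoin a disjoint copy of `ℝ` to both
spaces, which makes both masses infinite. -/
def cutDist {S₁ S₂ : Type*} [MeasurableSpace S₁] [MeasurableSpace S₂]
    (μ₁ : Measure S₁) (μ₂ : Measure S₂) (W₁ : S₁ → S₁ → ℝ) (W₂ : S₂ → S₂ → ℝ) : ℝ≥0∞ :=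
  if μ₁ Set.univ = μ₂ Set.univ then couplingCutDist μ₁ μ₂ W₁ W₂
  else couplingCutDist (extMeasure μ₁) (extMeasure μ₂) (extFun W₁) (extFun W₂)

end SigmaFiniteGraphon

end

/-! Cut distance zero gives special couplings `σ n` whose cut norms tend to 0; the theorem comes
from a limit of these. On σ-finite spaces such a limit need not be a coupling: mass above a fixed
set in one factor may escape to infinity in the other. One therefore works with sub-couplings, whose
marginals are only dominated by `μ₁` and `μ₂`. They form a compact set for convergence on rectangles
with sides of finite measure (`exists_tendsto_measureReal_prod`): embed each factor in `ℕ × 2^ℕ` so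
that its measure becomes finite on compact sets, and apply the Riesz theorem there.

Let `ρ` be the limit and `τᵢ` the mass of `μᵢ` missing from its marginals. Two facts are needed.

On `ρ` the graphons agree (`ae_eq_of_tendsto_measureReal_prod`). The integral of `W₁(x, x')` over a
product `C × D` depends only on the images in `S₁` of the measure restricted to `C` and to `D`. For
rectangles `C`, `D` these images converge setwise and are dominated by `μ₁`, which suffices to pass
to the limit against any integrable kernel. The same holds for `W₂`, so the limit of the cut norm
bounds forces the integrals of the difference to vanish.

The lost mass is invisible (`ae_eq_zero_of_tendsto_measureReal`): `W₁ = 0` almost everywhere for `τ₁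
× μ₁`, and likewise for `W₂`. Mass that escapes sits above the complement of a large set of `S₂`,
where the integral of `|W₂|` is small; by the cut norm bound the integrals of `W₁` over it are small
too.

Finally the lost mass of each space is coupled with a copy of itself placed in a real line adjoined
to the other space. Extended graphons vanish on the line, so the new blocks only require that `W₁`
and `W₂` vanish on lost mass. -/

namespace SigmaFiniteGraphon

open Filter Topology Set

/-! ### Setwise convergence of measures under a common dominating measure. -/

section Convergence

variable {ι Z : Type*} [MeasurableSpace Z]

/-- A limit can be computed on approximations that are uniformly good. -/
theorem tendsto_of_uniform_approx {l : Filter ι} {f : ι → ℝ} {a : ℝ}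
    (h : ∀ ε > 0, ∃ (g : ι → ℝ) (b : ℝ), Tendsto g l (𝓝 b) ∧ (∀ n, |f n - g n| ≤ ε) ∧ |a - b| ≤ ε) :
    Tendsto f l (𝓝 a) := by
  rw [Metric.tendsto_nhds]
  intro ε hε
  obtain ⟨g, b, hg, hfg, hab⟩ := h (ε / 4) (by positivity)
  filter_upwards [Metric.tendsto_nhds.1 hg (ε / 4) (by positivity)] with n hn
  rw [Real.dist_eq, abs_lt] at *
  have h1 := abs_le.1 (hfg n)
  have h2 := abs_le.1 hab
  constructor <;> linarith

/-- The error bound is the same for every `Q ≤ P`, which is what permits exchanging limits below. -/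
theorem abs_measureReal_sub_le {P Q : Measure Z} (hQ : Q ≤ P) {s t : Set Z} (hts : t ⊆ s)
    (ht : MeasurableSet t) (hs : P s < ∞) : |Q.real s - Q.real t| ≤ P.real (s \ t) := by
  have hQs : Q s ≠ ∞ := ((hQ s).trans_lt hs).ne
  rw [← measureReal_sdiff hts ht hQs, abs_of_nonneg measureReal_nonneg]
  exact ENNReal.toReal_mono (measure_ne_top_of_subset sdiff_subset hs.ne) (hQ _)

/-- Setwise convergence of measures dominated by `P` passes to increasing unions of finite
measure. -/
theorem tendsto_measureReal_of_monotone {P : Measure Z} {Q : ι → Measure Z} {Q₀ : Measure Z}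
    (hQ : ∀ n, Q n ≤ P) (hQ₀ : Q₀ ≤ P) {l : Filter ι} {t : ℕ → Set Z} (hmono : Monotone t)
    (ht : ∀ k, MeasurableSet (t k)) (hfin : P (⋃ k, t k) < ∞)
    (hconv : ∀ k, Tendsto (fun n => (Q n).real (t k)) l (𝓝 (Q₀.real (t k)))) :
    Tendsto (fun n => (Q n).real (⋃ k, t k)) l (𝓝 (Q₀.real (⋃ k, t k))) := by
  have h0 : Tendsto (fun k => P.real ((⋃ k, t k) \ t k)) atTop (𝓝 0) := by
    have h1 : Tendsto (fun k => P.real (t k)) atTop (𝓝 (P.real (⋃ k, t k))) :=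
      (ENNReal.tendsto_toReal hfin.ne).comp (tendsto_measure_iUnion_atTop hmono)
    have h2 := (tendsto_const_nhds (x := P.real (⋃ k, t k))).sub h1
    rw [sub_self] at h2
    refine h2.congr fun k => ?_
    rw [measureReal_sdiff (subset_iUnion t k) (ht k) hfin.ne]
  refine tendsto_of_uniform_approx fun ε hε => ?_
  obtain ⟨k, hk⟩ := ((tendsto_order.1 h0).2 ε hε).exists
  exact ⟨_, _, hconv k,
    fun n => (abs_measureReal_sub_le (hQ n) (subset_iUnion t k) (ht k) hfin).trans hk.le,
    (abs_measureReal_sub_le hQ₀ (subset_iUnion t k) (ht k) hfin).trans hk.le⟩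

/-- Measures dominated by `P` that converge on a generating π-system with an exhausting sequence
of sets of finite measure converge on all sets of finite measure. -/
theorem tendsto_measureReal_of_isPiSystem {P : Measure Z} {Q : ι → Measure Z} {Q₀ : Measure Z}
    (hQ : ∀ n, Q n ≤ P) (hQ₀ : Q₀ ≤ P) {l : Filter ι} {C : Set (Set Z)}
    (hgen : ‹MeasurableSpace Z› = MeasurableSpace.generateFrom C) (hpi : IsPiSystem C)
    {B : ℕ → Set Z} (hBC : ∀ k, B k ∈ C) (hB : Monotone B) (hBU : ⋃ k, B k = univ)
    (hBfin : ∀ k, P (B k) < ∞)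
    (hconv : ∀ s ∈ C, P s < ∞ → Tendsto (fun n => (Q n).real s) l (𝓝 (Q₀.real s)))
    {s : Set Z} (hs : MeasurableSet s) (hsfin : P s < ∞) :
    Tendsto (fun n => (Q n).real s) l (𝓝 (Q₀.real s)) := by
  have hBm : ∀ k, MeasurableSet (B k) := fun k => by
    rw [hgen]; exact MeasurableSpace.measurableSet_generateFrom (hBC k)
  -- The π-λ argument is run inside `B k`, where finiteness of the measure allows taking
  -- complements.
  have key : ∀ k, ∀ t, MeasurableSet t →
      Tendsto (fun n => (Q n).real (t ∩ B k)) l (𝓝 (Q₀.real (t ∩ B k))) := by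
    intro k
    have hfin : ∀ t, P (t ∩ B k) < ∞ := fun t =>
      measure_lt_top_of_subset inter_subset_right (hBfin k).ne
    refine MeasurableSpace.induction_on_inter hgen hpi ?_ ?_ ?_ ?_
    · simp [tendsto_const_nhds]
    · intro t ht
      rcases (t ∩ B k).eq_empty_or_nonempty with h | h
      · simp [h, tendsto_const_nhds]
      · exact hconv _ (hpi t ht _ (hBC k) h) (hfin t)
    · intro t ht h
      have e : ∀ Q' : Measure Z, Q' ≤ P → Q'.real (tᶜ ∩ B k) = Q'.real (B k) - Q'.real (t ∩ B k) := by
        intro Q' hQ'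
        rw [← measureReal_sdiff inter_subset_right (ht.inter (hBm k))
          ((hQ' _).trans_lt (hBfin k)).ne]
        congr 1
        ext x; simp; tauto
      rw [e Q₀ hQ₀]
      simp_rw [fun n => e (Q n) (hQ n)]
      exact (hconv _ (hBC k) (hBfin k)).sub h
    · intro f hd hf h
      have e : (⋃ i, f i) ∩ B k = ⋃ N : ℕ, ⋃ i ∈ Finset.range N, (f i ∩ B k) := by
        ext x
        simp only [mem_inter_iff, mem_iUnion, Finset.mem_range]
        constructor
        · rintro ⟨⟨i, hi⟩, hx⟩
          exact ⟨i + 1, i, by omega, hi, hx⟩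
        · rintro ⟨N, i, -, hi, hx⟩
          exact ⟨⟨i, hi⟩, hx⟩
      rw [e]
      refine tendsto_measureReal_of_monotone hQ hQ₀ ?_ ?_ (e ▸ hfin _) ?_
      · intro N M hNM
        exact biUnion_mono (fun i hi => by
          simp only [Finset.coe_range, mem_Iio] at hi ⊢
          exact lt_of_lt_of_le hi hNM) fun _ _ => Subset.rfl
      · exact fun N => Finset.measurableSet_biUnion _ fun i _ => (hf i).inter (hBm k)
      · intro N
        have e' : ∀ Q' : Measure Z, Q' ≤ P → Q'.real (⋃ i ∈ Finset.range N, (f i ∩ B k)) =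
            ∑ i ∈ Finset.range N, Q'.real (f i ∩ B k) := by
          intro Q' hQ'
          refine measureReal_biUnion_finset ?_ (fun i _ => (hf i).inter (hBm k)) ?_
          · exact fun i _ j _ hij => (hd hij).mono inter_subset_left inter_subset_left
          · exact fun i _ => ((hQ' _).trans_lt (hfin _)).ne
        rw [e' Q₀ hQ₀]
        simp_rw [fun n => e' (Q n) (hQ n)]
        exact tendsto_finsetSum _ fun i _ => h i
  have e : s = ⋃ k, s ∩ B k := by rw [← inter_iUnion, hBU, inter_univ]
  rw [e]
  exact tendsto_measureReal_of_monotone hQ hQ₀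
    (fun i j hij => inter_subset_inter_right _ (hB hij)) (fun k => hs.inter (hBm k)) (e ▸ hsfin)
    fun k => key k s hs

/-- Setwise convergence of measures dominated by `P` on the sets of finite measure implies
convergence of the integrals of all functions in `L¹(P)`. -/
theorem tendsto_integral_of_tendsto_measureReal {P : Measure Z} {Q : ι → Measure Z} {Q₀ : Measure Z}
    (hQ : ∀ n, Q n ≤ P) (hQ₀ : Q₀ ≤ P) {l : Filter ι}
    (hconv : ∀ s, MeasurableSet s → P s < ∞ → Tendsto (fun n => (Q n).real s) l (𝓝 (Q₀.real s)))
    {f : Z → ℝ} (hf : Integrable f P) :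
    Tendsto (fun n => ∫ z, f z ∂(Q n)) l (𝓝 (∫ z, f z ∂Q₀)) := by
  refine Integrable.induction
    (fun f => Tendsto (fun n => ∫ z, f z ∂(Q n)) l (𝓝 (∫ z, f z ∂Q₀))) ?_ ?_ ?_ ?_ hf
  · intro c s hs hfin
    simp only [integral_indicator_const _ hs, smul_eq_mul]
    exact (hconv _ hs hfin).mul_const c
  · intro f g _ hf hg ihf ihg
    have e : ∀ Q' : Measure Z, Q' ≤ P → ∫ z, (f + g) z ∂Q' = ∫ z, f z ∂Q' + ∫ z, g z ∂Q' :=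
      fun Q' hQ' => integral_add (hf.mono_measure hQ') (hg.mono_measure hQ')
    rw [e _ hQ₀]
    simp_rw [fun n => e _ (hQ n)]
    exact ihf.add ihg
  -- For all `Q' ≤ P` the integral is 1-Lipschitz in the `L¹(P)` norm, so approximation is uniform
  -- in `n`.
  · refine isClosed_of_closure_subset fun f hf => ?_
    refine tendsto_of_uniform_approx fun ε hε => ?_
    obtain ⟨g, hg, hfg⟩ := Metric.mem_closure_iff.1 hf ε hε
    have e : ∀ Q' : Measure Z, Q' ≤ P → |∫ z, f z ∂Q' - ∫ z, g z ∂Q'| ≤ ε := by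
      intro Q' hQ'
      have hfi := L1.integrable_coeFn f
      have hgi := L1.integrable_coeFn g
      rw [← integral_sub (hfi.mono_measure hQ') (hgi.mono_measure hQ')]
      rw [L1.dist_eq_integral_dist] at hfg
      calc |∫ z, (f z - g z) ∂Q'| ≤ ∫ z, ‖f z - g z‖ ∂Q' := by
            rw [← Real.norm_eq_abs]
            exact norm_integral_le_integral_norm _
        _ ≤ ∫ z, ‖f z - g z‖ ∂P :=
          integral_mono_measure hQ' (ae_of_all _ fun _ => norm_nonneg _) (hfi.sub hgi).norm
        _ ≤ ε := by simpa only [dist_eq_norm] using hfg.le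
    exact ⟨_, _, hg, fun n => e _ (hQ n), e _ hQ₀⟩
  · intro f g hfg _ h
    have e : ∀ Q' : Measure Z, Q' ≤ P → ∫ z, g z ∂Q' = ∫ z, f z ∂Q' :=
      fun Q' hQ' => (integral_congr_ae (ae_mono hQ' hfg)).symm
    rw [e _ hQ₀]
    simp_rw [fun n => e _ (hQ n)]
    exact h

end Convergence

/-! ### Compact open sets in totally disconnected locally compact spaces. -/

section CompactOpen

variable {X : Type*} [TopologicalSpace X] [T2Space X] [LocallyCompactSpace X]
  [TotallyDisconnectedSpace X]

variable (X) in
theorem isTopologicalBasis_isCompact_isOpen :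
    TopologicalSpace.IsTopologicalBasis {K : Set X | IsCompact K ∧ IsOpen K} := by
  refine TopologicalSpace.isTopologicalBasis_of_isOpen_of_nhds (fun K hK => hK.2) fun x U hx hU => ?_
  obtain ⟨K, hK, hxK⟩ := exists_compact_mem_nhds x
  obtain ⟨V, hV, hxV, hVU⟩ := (loc_compact_Haus_tot_disc_of_zero_dim (H := X)).mem_nhds_iff.1
    (inter_mem (hU.mem_nhds hx) hxK)
  exact ⟨V, ⟨hK.of_isClosed_subset hV.1 (hVU.trans inter_subset_right), hV.2⟩, hxV,
    hVU.trans inter_subset_left⟩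

variable [SecondCountableTopology X]

theorem exists_monotone_isCompact_isOpen {U : Set X} (hU : IsOpen U) :
    ∃ K : ℕ → Set X, Monotone K ∧ (∀ k, IsCompact (K k) ∧ IsOpen (K k)) ∧ ⋃ k, K k = U := by
  obtain ⟨S, hS, rfl⟩ := (isTopologicalBasis_isCompact_isOpen X).open_eq_sUnion hU
  obtain ⟨T, hTc, hTS, hTU⟩ := TopologicalSpace.isOpen_sUnion_countable S fun s hs => (hS hs).2
  obtain ⟨f, hf⟩ := (hTc.insert ∅).exists_eq_range (insert_nonempty _ _)
  have hfK : ∀ k, IsCompact (f k) ∧ IsOpen (f k) := fun k => by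
    have : f k ∈ insert ∅ T := hf ▸ mem_range_self k
    rcases this with h | h
    · rw [h]; exact ⟨isCompact_empty, isOpen_empty⟩
    · exact hS (hTS h)
  refine ⟨accumulate f, monotone_accumulate, fun k => ⟨?_, ?_⟩, ?_⟩
  · exact (finite_Iic k).isCompact_biUnion fun i _ => (hfK i).1
  · exact isOpen_biUnion fun i _ => (hfK i).2
  · rw [iUnion_accumulate, ← sUnion_range, ← hf, sUnion_insert, empty_union, hTU]

variable [TopologicalSpace.PseudoMetrizableSpace X] [MeasurableSpace X] [BorelSpace X]

theorem measure_le_of_isCompact_isOpen {α β : Measure X} [IsFiniteMeasureOnCompacts β]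
    (h : ∀ K, IsCompact K → IsOpen K → α K ≤ β K) : α ≤ β := by
  have hopen : ∀ U, IsOpen U → α U ≤ β U := by
    intro U hU
    obtain ⟨K, hK, hKc, rfl⟩ := exists_monotone_isCompact_isOpen hU
    rw [hK.measure_iUnion, hK.measure_iUnion]
    exact iSup_mono fun k => h _ (hKc k).1 (hKc k).2
  -- Local finiteness makes `β` outer regular, which reduces the comparison to open sets.
  have : IsLocallyFiniteMeasure β := ⟨fun x => by
    obtain ⟨K, hK, hx⟩ := exists_compact_mem_nhds x
    exact ⟨K, hx, hK.measure_lt_top⟩⟩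
  refine Measure.le_iff.2 fun s _ => ?_
  rw [s.measure_eq_iInf_isOpen β]
  exact le_iInf₂ fun U hU => le_iInf fun hUo => (measure_mono hU).trans (hopen U hUo)

end CompactOpen

/-! ### Vague limits from the Riesz representation theorem. -/

section Riesz

variable {ι X : Type*} [TopologicalSpace X] [T2Space X] [LocallyCompactSpace X]
  [MeasurableSpace X] [BorelSpace X]

/-- Vague compactness along an ultrafilter. -/
theorem exists_tendsto_integral_compactlySupported (l : Ultrafilter ι) (σ : ι → Measure X)
    (hσ : ∀ K, IsCompact K → ∃ c : ℝ≥0∞, c < ∞ ∧ ∀ n, σ n K ≤ c) :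
    ∃ ρ : Measure X, IsFiniteMeasureOnCompacts ρ ∧ ∀ f : CompactlySupportedContinuousMap X ℝ,
      Tendsto (fun n => ∫ x, f x ∂(σ n)) l (𝓝 (∫ x, f x ∂ρ)) := by
  have hfin : ∀ n, IsFiniteMeasureOnCompacts (σ n) := fun n => ⟨fun K hK => by
    obtain ⟨c, hc, h⟩ := hσ K hK
    exact (h n).trans_lt hc⟩
  have hint : ∀ (f : CompactlySupportedContinuousMap X ℝ) n, Integrable f (σ n) := fun f n =>
    f.continuous.integrable_of_hasCompactSupport f.hasCompactSupport
  -- The integrals of `f` stay in a fixed compact interval, so the ultrafilter limit exists;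
  -- linearity and positivity then pass to the limit.
  have hlim : ∀ f : CompactlySupportedContinuousMap X ℝ,
      ∃ a, Tendsto (fun n => ∫ x, f x ∂(σ n)) l (𝓝 a) := by
    intro f
    obtain ⟨c, hc, h⟩ := hσ _ f.hasCompactSupport
    obtain ⟨M, hM⟩ := f.hasCompactSupport.exists_bound_of_continuous f.continuous
    have hb : ∀ n, ∫ x, f x ∂(σ n) ∈ Icc (-(|M| * c.toReal)) (|M| * c.toReal) := by
      intro n
      rw [mem_Icc, ← abs_le, ← Real.norm_eq_abs]
      rw [← setIntegral_eq_integral_of_forall_compl_eq_zero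
        (s := tsupport f) (fun x hx => image_eq_zero_of_notMem_tsupport hx)]
      refine (norm_setIntegral_le_of_norm_le_const ((h n).trans_lt hc)
        fun x _ => (hM x).trans (le_abs_self M)).trans ?_
      exact mul_le_mul_of_nonneg_left (ENNReal.toReal_mono hc.ne (h n)) (abs_nonneg M)
    obtain ⟨a, -, ha⟩ := isCompact_Icc.ultrafilter_le_nhds'
      (l.map fun n => ∫ x, f x ∂(σ n)) (Filter.mem_map.2 (Filter.univ_mem' hb))
    exact ⟨a, ha⟩
  choose Λ hΛ using hlim
  let Λ' : CompactlySupportedContinuousMap X ℝ →ₚ[ℝ] ℝ :=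
  { toFun := Λ
    map_add' f g := by
      refine tendsto_nhds_unique (hΛ (f + g)) (((hΛ f).add (hΛ g)).congr fun n => ?_)
      exact (integral_add (hint f n) (hint g n)).symm
    map_smul' c f := by
      refine tendsto_nhds_unique (hΛ (c • f)) (((hΛ f).const_smul c).congr fun n => ?_)
      exact (integral_smul c _).symm
    monotone' f g hfg :=
      le_of_tendsto_of_tendsto' (hΛ f) (hΛ g) fun n => integral_mono (hint f n) (hint g n) hfg }
  refine ⟨RealRMK.rieszMeasure Λ', inferInstance, fun f => ?_⟩
  rw [RealRMK.integral_rieszMeasure]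
  exact hΛ f

/-- Vague compactness along an ultrafilter, tested on compact open sets. -/
theorem exists_tendsto_measureReal_isCompact_isOpen (l : Ultrafilter ι) (σ : ι → Measure X)
    (hσ : ∀ K, IsCompact K → ∃ c : ℝ≥0∞, c < ∞ ∧ ∀ n, σ n K ≤ c) :
    ∃ ρ : Measure X, IsFiniteMeasureOnCompacts ρ ∧ ∀ K, IsCompact K → IsOpen K →
      Tendsto (fun n => (σ n).real K) l (𝓝 (ρ.real K)) := by
  obtain ⟨ρ, hρ, h⟩ := exists_tendsto_integral_compactlySupported l σ hσ
  refine ⟨ρ, hρ, fun K hK hKo => ?_⟩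
  -- The indicator of a compact open set is itself a test function, since the frontier is empty.
  let f : CompactlySupportedContinuousMap X ℝ :=
    ⟨⟨K.indicator fun _ => 1, (continuous_const).indicator fun x hx => by
      simp [(IsClopen.frontier_eq ⟨hK.isClosed, hKo⟩)] at hx⟩,
      HasCompactSupport.intro hK fun x hx => by simp [hx]⟩
  have e : ∀ τ : Measure X, ∫ x, f x ∂τ = τ.real K := fun τ => by
    rw [← integral_indicator_one hK.measurableSet]; rfl
  simpa only [e] using h f

end Riesz

/-! ### Marginals of a measure restricted to a set, and convergence on rectangles. -/

section Slices

variable {ι X S T : Type*} [MeasurableSpace X] [MeasurableSpace S] [MeasurableSpace T]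

theorem map_restrict_le {φ : X → S} (hφ : Measurable φ) {σ : Measure X} {μ : Measure S}
    (h : σ.map φ ≤ μ) (C : Set X) : (σ.restrict C).map φ ≤ μ :=
  (Measure.map_mono Measure.restrict_le_self hφ).trans h

theorem map_restrict_real_apply {φ : X → S} (hφ : Measurable φ) (σ : Measure X) (C : Set X)
    {A : Set S} (hA : MeasurableSet A) :
    ((σ.restrict C).map φ).real A = σ.real (φ ⁻¹' A ∩ C) := by
  rw [map_measureReal_apply hφ hA, measureReal_restrict_apply (hφ hA)]

omit [MeasurableSpace S] [MeasurableSpace T] in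
theorem fst_preimage_inter_snd_preimage (A : Set S) (B : Set T) :
    (Prod.fst ⁻¹' A ∩ Prod.snd ⁻¹' B : Set (S × T)) = A ×ˢ B := rfl

/-- Convergence on a family of rectangles whose sides range over generating π-systems extends to
all rectangles with sides of finite measure. -/
theorem tendsto_measureReal_prod_of_isPiSystem {μ₁ : Measure S} {μ₂ : Measure T}
    {σ : ι → Measure (S × T)} {ρ : Measure (S × T)}
    (hσ₁ : ∀ n, (σ n).map Prod.fst ≤ μ₁) (hσ₂ : ∀ n, (σ n).map Prod.snd ≤ μ₂)
    (hρ₁ : ρ.map Prod.fst ≤ μ₁) (hρ₂ : ρ.map Prod.snd ≤ μ₂) {l : Filter ι}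
    {C : Set (Set S)} (hC : ‹MeasurableSpace S› = MeasurableSpace.generateFrom C)
    (hCpi : IsPiSystem C) {B : ℕ → Set S} (hBC : ∀ k, B k ∈ C) (hB : Monotone B)
    (hBU : ⋃ k, B k = univ) (hBfin : ∀ k, μ₁ (B k) < ∞)
    {D : Set (Set T)} (hD : ‹MeasurableSpace T› = MeasurableSpace.generateFrom D)
    (hDpi : IsPiSystem D) {E : ℕ → Set T} (hED : ∀ k, E k ∈ D) (hE : Monotone E)
    (hEU : ⋃ k, E k = univ) (hEfin : ∀ k, μ₂ (E k) < ∞)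
    (hconv : ∀ s ∈ C, ∀ t ∈ D, Tendsto (fun n => (σ n).real (s ×ˢ t)) l (𝓝 (ρ.real (s ×ˢ t))))
    {s : Set S} (hs : MeasurableSet s) (hsfin : μ₁ s < ∞)
    {t : Set T} (ht : MeasurableSet t) (htfin : μ₂ t < ∞) :
    Tendsto (fun n => (σ n).real (s ×ˢ t)) l (𝓝 (ρ.real (s ×ˢ t))) := by
  -- One side is extended at a time: with `t` fixed, the rectangle measures are a measure in `s`
  -- dominated by `μ₁`.
  have h1 : ∀ t ∈ D, Tendsto (fun n => (σ n).real (s ×ˢ t)) l (𝓝 (ρ.real (s ×ˢ t))) := by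
    intro t ht
    have := tendsto_measureReal_of_isPiSystem
      (fun n => map_restrict_le measurable_fst (hσ₁ n) (Prod.snd ⁻¹' t))
      (map_restrict_le measurable_fst hρ₁ (Prod.snd ⁻¹' t)) (l := l) hC hCpi hBC hB hBU hBfin
      (fun s hs _ => by
        have hsm : MeasurableSet s := by
          rw [hC]; exact MeasurableSpace.measurableSet_generateFrom hs
        simp only [map_restrict_real_apply measurable_fst _ _ hsm, fst_preimage_inter_snd_preimage]
        exact hconv s hs t ht) hs hsfin
    simpa only [map_restrict_real_apply measurable_fst _ _ hs, fst_preimage_inter_snd_preimage]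
      using this
  have := tendsto_measureReal_of_isPiSystem
    (fun n => map_restrict_le measurable_snd (hσ₂ n) (Prod.fst ⁻¹' s))
    (map_restrict_le measurable_snd hρ₂ (Prod.fst ⁻¹' s)) (l := l) hD hDpi hED hE hEU hEfin
    (fun t ht _ => by
      have htm : MeasurableSet t := by
        rw [hD]; exact MeasurableSpace.measurableSet_generateFrom ht
      simp only [map_restrict_real_apply measurable_snd _ _ htm, inter_comm (Prod.snd ⁻¹' t),
        fst_preimage_inter_snd_preimage]
      exact h1 t ht) ht htfin
  simpa only [map_restrict_real_apply measurable_snd _ _ ht, inter_comm (Prod.snd ⁻¹' t),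
        fst_preimage_inter_snd_preimage] using this

end Slices

/-! ### Compactness of sub-couplings. -/

section Limit

theorem isPiSystem_isCompact_isOpen {X : Type*} [TopologicalSpace X] [T2Space X] :
    IsPiSystem {K : Set X | IsCompact K ∧ IsOpen K} :=
  fun _ hs _ ht _ => ⟨hs.1.inter ht.1, hs.2.inter ht.2⟩

theorem measurableSpace_eq_generateFrom_isCompact_isOpen {X : Type*} [TopologicalSpace X]
    [T2Space X] [LocallyCompactSpace X] [TotallyDisconnectedSpace X] [SecondCountableTopology X]
    [MeasurableSpace X] [BorelSpace X] :
    ‹MeasurableSpace X› = MeasurableSpace.generateFrom {K : Set X | IsCompact K ∧ IsOpen K} := by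
  rw [← (isTopologicalBasis_isCompact_isOpen X).borel_eq_generateFrom]
  exact BorelSpace.measurable_eq

theorem measure_le_of_tendsto_measureReal {ι X : Type*} [MeasurableSpace X] {l : Filter ι}
    [l.NeBot] {σ : ι → Measure X} {ρ : Measure X} {s : Set X} {c : ℝ≥0∞} (hc : c ≠ ∞)
    (hρ : ρ s ≠ ∞) (h : ∀ n, σ n s ≤ c)
    (hconv : Tendsto (fun n => (σ n).real s) l (𝓝 (ρ.real s))) : ρ s ≤ c := by
  rw [← ENNReal.toReal_le_toReal hρ hc]
  exact le_of_tendsto' hconv fun n => ENNReal.toReal_mono hc (h n)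

section Topological

variable {ι X Y : Type*}
  [TopologicalSpace X] [T2Space X] [LocallyCompactSpace X] [TotallyDisconnectedSpace X]
  [SecondCountableTopology X] [TopologicalSpace.PseudoMetrizableSpace X] [MeasurableSpace X]
  [BorelSpace X]
  [TopologicalSpace Y] [T2Space Y] [LocallyCompactSpace Y] [TotallyDisconnectedSpace Y]
  [SecondCountableTopology Y] [TopologicalSpace.PseudoMetrizableSpace Y] [MeasurableSpace Y]
  [BorelSpace Y]

/-- A compact set in the product has `σ n`-measure at most the `μ₁`-measure of its projection, so a
vague limit exists. It is tested on products of compact open sets, which generate enough to reach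
all rectangles with sides of finite measure. -/
theorem exists_tendsto_measureReal_prod_of_borelSpace (l : Ultrafilter ι)
    {μ₁ : Measure X} {μ₂ : Measure Y} [IsFiniteMeasureOnCompacts μ₁] [IsFiniteMeasureOnCompacts μ₂]
    {σ : ι → Measure (X × Y)} (hσ₁ : ∀ n, (σ n).map Prod.fst ≤ μ₁)
    (hσ₂ : ∀ n, (σ n).map Prod.snd ≤ μ₂) :
    ∃ ρ : Measure (X × Y), ρ.map Prod.fst ≤ μ₁ ∧ ρ.map Prod.snd ≤ μ₂ ∧
      ∀ s, MeasurableSet s → μ₁ s < ∞ → ∀ t, MeasurableSet t → μ₂ t < ∞ →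
        Tendsto (fun n => (σ n).real (s ×ˢ t)) l (𝓝 (ρ.real (s ×ˢ t))) := by
  have h1 : ∀ n s t, MeasurableSet s → σ n (s ×ˢ t) ≤ μ₁ s := fun n s t hs =>
    (measure_mono fun z hz => hz.1).trans
      ((Measure.map_apply measurable_fst hs).symm.le.trans (hσ₁ n s))
  have h2 : ∀ n s t, MeasurableSet t → σ n (s ×ˢ t) ≤ μ₂ t := fun n s t ht =>
    (measure_mono fun z hz => hz.2).trans
      ((Measure.map_apply measurable_snd ht).symm.le.trans (hσ₂ n t))
  obtain ⟨ρ, hρ, hconv⟩ := exists_tendsto_measureReal_isCompact_isOpen l σ fun K hK => by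
    have hc := (hK.image continuous_fst)
    refine ⟨μ₁ (Prod.fst '' K), hc.measure_lt_top, fun n => ?_⟩
    refine (measure_mono ?_).trans (h1 n _ univ hc.measurableSet)
    exact fun z hz => ⟨mem_image_of_mem _ hz, mem_univ _⟩
  obtain ⟨B, hBm, hBc, hBU⟩ := exists_monotone_isCompact_isOpen (isOpen_univ (X := X))
  obtain ⟨E, hEm, hEc, hEU⟩ := exists_monotone_isCompact_isOpen (isOpen_univ (X := Y))
  have hρ₁ : ρ.map Prod.fst ≤ μ₁ := by
    refine measure_le_of_isCompact_isOpen fun K hK hKo => ?_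
    -- Convergence is known only on the compact pieces `K ×ˢ E k`. Mass may escape along the second
    -- factor, so only an inequality between marginals survives.
    have e : (Prod.fst ⁻¹' K : Set (X × Y)) = ⋃ k, K ×ˢ E k := by
      rw [← prod_iUnion, hEU, prod_univ]
    rw [Measure.map_apply measurable_fst hK.measurableSet, e, Monotone.measure_iUnion
      fun i j hij => prod_mono_right (hEm hij)]
    refine iSup_le fun k => ?_
    have hc := hK.prod (hEc k).1
    exact measure_le_of_tendsto_measureReal hK.measure_lt_top.ne hc.measure_lt_top.ne
      (fun n => h1 n _ _ hK.measurableSet) (hconv _ hc (hKo.prod (hEc k).2))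
  have hρ₂ : ρ.map Prod.snd ≤ μ₂ := by
    refine measure_le_of_isCompact_isOpen fun K hK hKo => ?_
    have e : (Prod.snd ⁻¹' K : Set (X × Y)) = ⋃ k, B k ×ˢ K := by
      rw [← iUnion_prod_const, hBU, univ_prod]
    rw [Measure.map_apply measurable_snd hK.measurableSet, e, Monotone.measure_iUnion
      fun i j hij => prod_mono_left (hBm hij)]
    refine iSup_le fun k => ?_
    have hc := (hBc k).1.prod hK
    exact measure_le_of_tendsto_measureReal hK.measure_lt_top.ne hc.measure_lt_top.ne
      (fun n => h2 n _ _ hK.measurableSet) (hconv _ hc ((hBc k).2.prod hKo))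
  refine ⟨ρ, hρ₁, hρ₂, fun s hs hsf t ht htf => ?_⟩
  exact tendsto_measureReal_prod_of_isPiSystem hσ₁ hσ₂ hρ₁ hρ₂
    measurableSpace_eq_generateFrom_isCompact_isOpen isPiSystem_isCompact_isOpen hBc hBm hBU
    (fun k => (hBc k).1.measure_lt_top)
    measurableSpace_eq_generateFrom_isCompact_isOpen isPiSystem_isCompact_isOpen hEc hEm hEU
    (fun k => (hEc k).1.measure_lt_top)
    (fun s hs t ht => hconv _ (hs.1.prod ht.1) (hs.2.prod ht.2)) hs hsf ht htf

end Topological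

/-- A standard Borel space with a `σ`-finite measure embeds into the locally compact space
`ℕ × 2^ℕ` in such a way that the image measure is finite on compact sets. -/
theorem exists_measurableEmbedding_isFiniteMeasureOnCompacts {S : Type*} [MeasurableSpace S]
    [StandardBorelSpace S] (μ : Measure S) [SigmaFinite μ] :
    ∃ e : S → ℕ × (ℕ → Bool), MeasurableEmbedding e ∧ IsFiniteMeasureOnCompacts (μ.map e) := by
  let e : S → ℕ × (ℕ → Bool) :=
    fun x => (spanningSetsIndex μ x, MeasurableSpace.mapNatBool S x)
  have he : Measurable e := (measurableSet_spanningSetsIndex μ).prodMk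
    (MeasurableSpace.measurable_mapNatBool S)
  have hinj : Function.Injective e := fun x y h =>
    MeasurableSpace.injective_mapNatBool S (Prod.ext_iff.1 h).2
  refine ⟨e, he.measurableEmbedding hinj, ⟨fun K hK => ?_⟩⟩
  -- A compact set meets finitely many levels of `ℕ`, and the points up to level `N` lie in a
  -- spanning set of finite measure.
  obtain ⟨N, hN⟩ := (hK.image continuous_fst).bddAbove
  rw [Measure.map_apply he hK.measurableSet]
  refine (measure_mono (t := spanningSets μ N) fun x hx => ?_).trans_lt
    (measure_spanningSets_lt_top μ N)
  exact mem_spanningSets_of_index_le μ x (hN (mem_image_of_mem Prod.fst hx))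

variable {ι S T : Type*} [MeasurableSpace S] [StandardBorelSpace S] [MeasurableSpace T]
  [StandardBorelSpace T]

/-- Compactness of the set of sub-couplings of two `σ`-finite measures on standard Borel spaces. -/
theorem exists_tendsto_measureReal_prod (l : Ultrafilter ι)
    {μ₁ : Measure S} {μ₂ : Measure T} [SigmaFinite μ₁] [SigmaFinite μ₂]
    {σ : ι → Measure (S × T)} (hσ₁ : ∀ n, (σ n).map Prod.fst ≤ μ₁)
    (hσ₂ : ∀ n, (σ n).map Prod.snd ≤ μ₂) :
    ∃ ρ : Measure (S × T), ρ.map Prod.fst ≤ μ₁ ∧ ρ.map Prod.snd ≤ μ₂ ∧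
      ∀ s, MeasurableSet s → μ₁ s < ∞ → ∀ t, MeasurableSet t → μ₂ t < ∞ →
        Tendsto (fun n => (σ n).real (s ×ˢ t)) l (𝓝 (ρ.real (s ×ˢ t))) := by
  obtain ⟨e₁, he₁, _⟩ := exists_measurableEmbedding_isFiniteMeasureOnCompacts μ₁
  obtain ⟨e₂, he₂, _⟩ := exists_measurableEmbedding_isFiniteMeasureOnCompacts μ₂
  have he : MeasurableEmbedding (Prod.map e₁ e₂) := he₁.prodMap he₂
  obtain ⟨ρ, hρ₁, hρ₂, hρ⟩ := exists_tendsto_measureReal_prod_of_borelSpace l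
    (μ₁ := μ₁.map e₁) (μ₂ := μ₂.map e₂) (σ := fun n => (σ n).map (Prod.map e₁ e₂))
    (fun n => by
      rw [Measure.map_map measurable_fst he.measurable]
      change Measure.map (e₁ ∘ Prod.fst) (σ n) ≤ _
      rw [← Measure.map_map he₁.measurable measurable_fst]
      exact Measure.map_mono (hσ₁ n) he₁.measurable)
    (fun n => by
      rw [Measure.map_map measurable_snd he.measurable]
      change Measure.map (e₂ ∘ Prod.snd) (σ n) ≤ _
      rw [← Measure.map_map he₂.measurable measurable_snd]
      exact Measure.map_mono (hσ₂ n) he₂.measurable)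
  -- Pulling back ignores mass outside the image, which preserves upper bounds on marginals; the
  -- rectangles of interest are mapped into the image.
  refine ⟨ρ.comap (Prod.map e₁ e₂), ?_, ?_, ?_⟩
  · refine Measure.le_iff.2 fun A hA => ?_
    rw [Measure.map_apply measurable_fst hA, he.comap_apply]
    refine (measure_mono (t := Prod.fst ⁻¹' (e₁ '' A)) ?_).trans ?_
    · rintro _ ⟨z, hz, rfl⟩
      exact ⟨z.1, hz, rfl⟩
    · rw [← Measure.map_apply measurable_fst (he₁.measurableSet_image.2 hA)]
      refine (hρ₁ _).trans ?_
      rw [he₁.map_apply, he₁.injective.preimage_image]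
  · refine Measure.le_iff.2 fun A hA => ?_
    rw [Measure.map_apply measurable_snd hA, he.comap_apply]
    refine (measure_mono (t := Prod.snd ⁻¹' (e₂ '' A)) ?_).trans ?_
    · rintro _ ⟨z, hz, rfl⟩
      exact ⟨z.2, hz, rfl⟩
    · rw [← Measure.map_apply measurable_snd (he₂.measurableSet_image.2 hA)]
      refine (hρ₂ _).trans ?_
      rw [he₂.map_apply, he₂.injective.preimage_image]
  · intro s hs hsf t ht htf
    have h := hρ (e₁ '' s) (he₁.measurableSet_image.2 hs)
      (by rwa [he₁.map_apply, he₁.injective.preimage_image]) (e₂ '' t)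
      (he₂.measurableSet_image.2 ht) (by rwa [he₂.map_apply, he₂.injective.preimage_image])
    simp only [measureReal_def, he.map_apply, he.comap_apply, ← prodMap_image_prod,
      he.injective.preimage_image] at h ⊢
    exact h

end Limit

/-! ### The generating π-system of sets of finite measure. -/

section FiniteMeasureSets

variable {S : Type*} [MeasurableSpace S]

theorem isPiSystem_measurableSet_lt_top (μ : Measure S) :
    IsPiSystem {s | MeasurableSet s ∧ μ s < ∞} :=
  fun _ hs _ ht _ => ⟨hs.1.inter ht.1, (measure_mono inter_subset_left).trans_lt hs.2⟩

variable (μ : Measure S) [SigmaFinite μ]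

theorem spanningSets_mem_measurableSet_lt_top (k : ℕ) :
    spanningSets μ k ∈ {s | MeasurableSet s ∧ μ s < ∞} :=
  ⟨measurableSet_spanningSets μ k, measure_spanningSets_lt_top μ k⟩

theorem generateFrom_measurableSet_lt_top :
    MeasurableSpace.generateFrom {s | MeasurableSet s ∧ μ s < ∞} = ‹MeasurableSpace S› := by
  refine le_antisymm (MeasurableSpace.generateFrom_le fun s hs => hs.1) fun s hs => ?_
  have e : s = ⋃ k, s ∩ spanningSets μ k := by
    rw [← inter_iUnion, iUnion_spanningSets, inter_univ]
  rw [e]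
  refine MeasurableSet.iUnion fun k => MeasurableSpace.measurableSet_generateFrom ?_
  exact ⟨hs.inter (measurableSet_spanningSets μ k),
    (measure_mono inter_subset_right).trans_lt (measure_spanningSets_lt_top μ k)⟩

theorem isCountablySpanning_measurableSet_lt_top :
    IsCountablySpanning {s | MeasurableSet s ∧ μ s < ∞} :=
  ⟨spanningSets μ, spanningSets_mem_measurableSet_lt_top μ, iUnion_spanningSets μ⟩

end FiniteMeasureSets

/-! ### Vanishing of a function from vanishing integrals on a π-system. -/

section ZeroIntegral

variable {Z : Type*} [MeasurableSpace Z]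

/-- An integrable function whose integrals over the sets of an exhausting generating π-system
vanish is zero almost everywhere. -/
theorem ae_eq_zero_of_setIntegral_eq_zero_of_isPiSystem {P : Measure Z} {C : Set (Set Z)}
    (hgen : ‹MeasurableSpace Z› = MeasurableSpace.generateFrom C) (hpi : IsPiSystem C)
    {B : ℕ → Set Z} (hBC : ∀ k, B k ∈ C) (hB : Monotone B) (hBU : ⋃ k, B k = univ)
    {f : Z → ℝ} (hf : Integrable f P) (h0 : ∀ s ∈ C, ∫ z in s, f z ∂P = 0) : f =ᵐ[P] 0 := by
  have hBm : ∀ k, MeasurableSet (B k) := fun k => by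
    rw [hgen]; exact MeasurableSpace.measurableSet_generateFrom (hBC k)
  have key : ∀ k, ∀ t, MeasurableSet t → ∫ z in t ∩ B k, f z ∂P = 0 := by
    intro k
    refine MeasurableSpace.induction_on_inter hgen hpi ?_ ?_ ?_ ?_
    · simp
    · intro t ht
      rcases (t ∩ B k).eq_empty_or_nonempty with h | h
      · simp [h]
      · exact h0 _ (hpi t ht _ (hBC k) h)
    · intro t ht h
      have := integral_inter_add_sdiff (s := B k) ht hf.integrableOn
      rw [h0 _ (hBC k), inter_comm (B k), h, zero_add] at this
      rwa [inter_comm, ← sdiff_eq]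
    · intro f' hd hf' h
      rw [iUnion_inter, integral_iUnion (fun i => (hf' i).inter (hBm k))
        (fun i j hij => (hd hij).mono inter_subset_left inter_subset_left) hf.integrableOn]
      simp [h]
  refine hf.ae_eq_zero_of_forall_setIntegral_eq_zero fun s hs _ => ?_
  have hmono : Monotone fun k => s ∩ B k := fun i j hij => inter_subset_inter_right _ (hB hij)
  have := tendsto_setIntegral_of_monotone (μ := P) (f := f) (fun k => hs.inter (hBm k)) hmono
    hf.integrableOn
  simp only [key _ s hs, ← inter_iUnion, hBU, inter_univ] at this
  exact (tendsto_nhds_unique this tendsto_const_nhds)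

end ZeroIntegral

/-! ### Convergence of integrals against products of marginals. -/

section ProductConvergence

variable {ι S T X : Type*} [MeasurableSpace S] [MeasurableSpace T] [MeasurableSpace X]

theorem sigmaFinite_of_map_le {φ : X → S} (hφ : Measurable φ) {σ : Measure X} {μ : Measure S}
    [SigmaFinite μ] (h : σ.map φ ≤ μ) : SigmaFinite σ := by
  have : SigmaFinite (σ.map φ) := Measure.sigmaFinite_of_le μ h
  exact SigmaFinite.of_map σ hφ.aemeasurable this

/-- Products of setwise convergent dominated measures converge on `L¹`. -/
theorem tendsto_integral_prod_of_tendsto_measureReal {μ : Measure S} {κ : Measure T}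
    [SigmaFinite μ] [SigmaFinite κ] {Q : ι → Measure S} {Q₀ : Measure S}
    {Q' : ι → Measure T} {Q₀' : Measure T} (hQ : ∀ n, Q n ≤ μ) (hQ₀ : Q₀ ≤ μ)
    (hQ' : ∀ n, Q' n ≤ κ) (hQ₀' : Q₀' ≤ κ) {l : Filter ι}
    (hconv : ∀ s, MeasurableSet s → μ s < ∞ → Tendsto (fun n => (Q n).real s) l (𝓝 (Q₀.real s)))
    (hconv' : ∀ s, MeasurableSet s → κ s < ∞ →
      Tendsto (fun n => (Q' n).real s) l (𝓝 (Q₀'.real s)))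
    {f : S × T → ℝ} (hf : Integrable f (μ.prod κ)) :
    Tendsto (fun n => ∫ z, f z ∂((Q n).prod (Q' n))) l (𝓝 (∫ z, f z ∂(Q₀.prod Q₀'))) := by
  have : ∀ n, SigmaFinite (Q n) := fun n => Measure.sigmaFinite_of_le μ (hQ n)
  have : ∀ n, SigmaFinite (Q' n) := fun n => Measure.sigmaFinite_of_le κ (hQ' n)
  have : SigmaFinite Q₀ := Measure.sigmaFinite_of_le μ hQ₀
  have : SigmaFinite Q₀' := Measure.sigmaFinite_of_le κ hQ₀'
  refine tendsto_integral_of_tendsto_measureReal (fun n => Measure.prod_mono (hQ n) (hQ' n))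
    (Measure.prod_mono hQ₀ hQ₀') (fun s hs hsf => ?_) hf
  refine tendsto_measureReal_of_isPiSystem (fun n => Measure.prod_mono (hQ n) (hQ' n))
    (Measure.prod_mono hQ₀ hQ₀')
    (generateFrom_eq_prod (generateFrom_measurableSet_lt_top μ)
      (generateFrom_measurableSet_lt_top κ) (isCountablySpanning_measurableSet_lt_top μ)
      (isCountablySpanning_measurableSet_lt_top κ)).symm
    ((isPiSystem_measurableSet_lt_top μ).prod (isPiSystem_measurableSet_lt_top κ))
    (B := fun k => spanningSets μ k ×ˢ spanningSets κ k)
    (fun k => mem_image2_of_mem (spanningSets_mem_measurableSet_lt_top μ k)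
      (spanningSets_mem_measurableSet_lt_top κ k))
    (fun i j hij => prod_mono (monotone_spanningSets μ hij) (monotone_spanningSets κ hij))
    ?_ ?_ ?_ hs hsf
  · rw [iUnion_prod_of_monotone (monotone_spanningSets μ) (monotone_spanningSets κ),
      iUnion_spanningSets, iUnion_spanningSets, univ_prod_univ]
  · intro k
    rw [Measure.prod_prod]
    exact ENNReal.mul_lt_top (measure_spanningSets_lt_top μ k) (measure_spanningSets_lt_top κ k)
  · rintro _ ⟨s, hs, t, ht, rfl⟩ -
    simp only [measureReal_prod_prod]
    exact (hconv s hs.1 hs.2).mul (hconv' t ht.1 ht.2)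

/-- Change of variables over a product set, in terms of the two slices. -/
theorem setIntegral_prod_comp {φ : X → S} (hφ : Measurable φ) {σ : Measure X} {μ : Measure S}
    [SigmaFinite μ] (hσ : σ.map φ ≤ μ) (C D : Set X) {F : S × S → ℝ}
    (hF : AEStronglyMeasurable F (μ.prod μ)) :
    ∫ z in C ×ˢ D, F (φ z.1, φ z.2) ∂(σ.prod σ) =
      ∫ w, F w ∂(((σ.restrict C).map φ).prod ((σ.restrict D).map φ)) := by
  have : SigmaFinite σ := sigmaFinite_of_map_le hφ hσ
  have hC := map_restrict_le hφ hσ C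
  have hD := map_restrict_le hφ hσ D
  have : SigmaFinite ((σ.restrict D).map φ) := Measure.sigmaFinite_of_le μ hD
  have : SigmaFinite ((σ.restrict C).map φ) := Measure.sigmaFinite_of_le μ hC
  rw [Measure.map_prod_map _ _ hφ hφ, integral_map (hφ.prodMap hφ).aemeasurable,
    Measure.prod_restrict]
  · rfl
  · rw [← Measure.map_prod_map _ _ hφ hφ]
    exact hF.mono_measure (Measure.prod_mono hC hD)

theorem integrable_comp_prod {φ : X → S} (hφ : Measurable φ) {σ : Measure X} {μ : Measure S}
    [SigmaFinite μ] (hσ : σ.map φ ≤ μ) {F : S × S → ℝ} (hF : Integrable F (μ.prod μ)) :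
    Integrable (fun z : X × X => F (φ z.1, φ z.2)) (σ.prod σ) := by
  have : SigmaFinite σ := sigmaFinite_of_map_le hφ hσ
  have : SigmaFinite (σ.map φ) := Measure.sigmaFinite_of_le μ hσ
  have h := hF.mono_measure (Measure.prod_mono hσ hσ)
  rw [Measure.map_prod_map _ _ hφ hφ] at h
  exact h.comp_measurable (hφ.prodMap hφ)

/-- Convergence of the integrals of a pulled back function over a product of sets whose slices
converge. -/
theorem tendsto_setIntegral_prod_comp {φ : X → S} (hφ : Measurable φ) {μ : Measure S}
    [SigmaFinite μ] {σ : ι → Measure X} {ρ : Measure X} (hσ : ∀ n, (σ n).map φ ≤ μ)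
    (hρ : ρ.map φ ≤ μ) {l : Filter ι} {C D : Set X}
    (hC : ∀ s, MeasurableSet s → μ s < ∞ →
      Tendsto (fun n => (σ n).real (φ ⁻¹' s ∩ C)) l (𝓝 (ρ.real (φ ⁻¹' s ∩ C))))
    (hD : ∀ s, MeasurableSet s → μ s < ∞ →
      Tendsto (fun n => (σ n).real (φ ⁻¹' s ∩ D)) l (𝓝 (ρ.real (φ ⁻¹' s ∩ D))))
    {F : S × S → ℝ} (hF : Integrable F (μ.prod μ)) :
    Tendsto (fun n => ∫ z in C ×ˢ D, F (φ z.1, φ z.2) ∂((σ n).prod (σ n))) l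
      (𝓝 (∫ z in C ×ˢ D, F (φ z.1, φ z.2) ∂(ρ.prod ρ))) := by
  rw [setIntegral_prod_comp hφ hρ _ _ hF.1]
  simp_rw [fun n => setIntegral_prod_comp hφ (hσ n) C D hF.1]
  refine tendsto_integral_prod_of_tendsto_measureReal
    (fun n => map_restrict_le hφ (hσ n) C) (map_restrict_le hφ hρ C)
    (fun n => map_restrict_le hφ (hσ n) D) (map_restrict_le hφ hρ D) ?_ ?_ hF
  · intro s hs hsf
    simp only [map_restrict_real_apply hφ _ _ hs]
    exact hC s hs hsf
  · intro s hs hsf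
    simp only [map_restrict_real_apply hφ _ _ hs]
    exact hD s hs hsf

end ProductConvergence

/-! ### Agreement on the limit, and vanishing on the lost mass. -/

section LimitCoupling

variable {ι S T : Type*} [MeasurableSpace S] [MeasurableSpace T]

/-- If the cut norms along a sequence of sub-couplings tend to zero, then the two pulled back
functions agree almost everywhere for a limiting sub-coupling. -/
theorem ae_eq_of_tendsto_measureReal_prod {μ : Measure S} {κ : Measure T} [SigmaFinite μ]
    [SigmaFinite κ] {l : Filter ι} [l.NeBot] {σ : ι → Measure (S × T)} {ρ : Measure (S × T)}
    (hσ₁ : ∀ n, (σ n).map Prod.fst ≤ μ) (hσ₂ : ∀ n, (σ n).map Prod.snd ≤ κ)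
    (hρ₁ : ρ.map Prod.fst ≤ μ) (hρ₂ : ρ.map Prod.snd ≤ κ)
    (hconv : ∀ s, MeasurableSet s → μ s < ∞ → ∀ t, MeasurableSet t → κ t < ∞ →
      Tendsto (fun n => (σ n).real (s ×ˢ t)) l (𝓝 (ρ.real (s ×ˢ t))))
    {F : S × S → ℝ} {G : T × T → ℝ} (hF : Integrable F (μ.prod μ)) (hG : Integrable G (κ.prod κ))
    {ε : ι → ℝ} (hε : Tendsto ε l (𝓝 0))
    (hcut : ∀ n, ∀ C D : Set (S × T), MeasurableSet C → MeasurableSet D →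
      |∫ z in C ×ˢ D, (F (z.1.1, z.2.1) - G (z.1.2, z.2.2)) ∂((σ n).prod (σ n))| ≤ ε n) :
    ∀ᵐ z : (S × T) × (S × T) ∂(ρ.prod ρ), F (z.1.1, z.2.1) = G (z.1.2, z.2.2) := by
  have hFi : ∀ σ : Measure (S × T), σ.map Prod.fst ≤ μ →
      Integrable (fun z : (S × T) × (S × T) => F (z.1.1, z.2.1)) (σ.prod σ) :=
    fun σ h => integrable_comp_prod measurable_fst h hF
  have hGi : ∀ σ : Measure (S × T), σ.map Prod.snd ≤ κ →
      Integrable (fun z : (S × T) × (S × T) => G (z.1.2, z.2.2)) (σ.prod σ) :=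
    fun σ h => integrable_comp_prod measurable_snd h hG
  let R : Set (Set (S × T)) := image2 (· ×ˢ ·) {s | MeasurableSet s ∧ μ s < ∞}
    {t | MeasurableSet t ∧ κ t < ∞}
  have hRm : ∀ C ∈ R, MeasurableSet C := by
    rintro _ ⟨s, hs, t, ht, rfl⟩
    exact hs.1.prod ht.1
  have hRgen : MeasurableSpace.generateFrom R = Prod.instMeasurableSpace :=
    generateFrom_eq_prod (generateFrom_measurableSet_lt_top μ)
      (generateFrom_measurableSet_lt_top κ) (isCountablySpanning_measurableSet_lt_top μ)
      (isCountablySpanning_measurableSet_lt_top κ)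
  have hRpi : IsPiSystem R :=
    (isPiSystem_measurableSet_lt_top μ).prod (isPiSystem_measurableSet_lt_top κ)
  let E : ℕ → Set (S × T) := fun k => spanningSets μ k ×ˢ spanningSets κ k
  have hER : ∀ k, E k ∈ R := fun k => mem_image2_of_mem (spanningSets_mem_measurableSet_lt_top μ k)
      (spanningSets_mem_measurableSet_lt_top κ k)
  have hEm : Monotone E := fun i j hij =>
    prod_mono (monotone_spanningSets μ hij) (monotone_spanningSets κ hij)
  have hEU : ⋃ k, E k = univ := by
    rw [iUnion_prod_of_monotone (monotone_spanningSets μ) (monotone_spanningSets κ),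
      iUnion_spanningSets, iUnion_spanningSets, univ_prod_univ]
  have hslice₁ : ∀ C ∈ R, ∀ s, MeasurableSet s → μ s < ∞ →
      Tendsto (fun n => (σ n).real (Prod.fst ⁻¹' s ∩ C)) l (𝓝 (ρ.real (Prod.fst ⁻¹' s ∩ C))) := by
    rintro _ ⟨s', hs', t, ht, rfl⟩ s hs hsf
    have e : (Prod.fst ⁻¹' s ∩ s' ×ˢ t : Set (S × T)) = (s ∩ s') ×ˢ t := by
      ext z; simp [and_assoc]
    simp only [e]
    exact hconv _ (hs.inter hs'.1) ((measure_mono inter_subset_left).trans_lt hsf) t ht.1 ht.2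
  have hslice₂ : ∀ C ∈ R, ∀ t, MeasurableSet t → κ t < ∞ →
      Tendsto (fun n => (σ n).real (Prod.snd ⁻¹' t ∩ C)) l (𝓝 (ρ.real (Prod.snd ⁻¹' t ∩ C))) := by
    rintro _ ⟨s, hs, t', ht', rfl⟩ t ht htf
    have e : (Prod.snd ⁻¹' t ∩ s ×ˢ t' : Set (S × T)) = s ×ˢ (t ∩ t') := by
      ext z; simp; tauto
    simp only [e]
    exact hconv s hs.1 hs.2 _ (ht.inter ht'.1) ((measure_mono inter_subset_left).trans_lt htf)
  have key : (fun z : (S × T) × (S × T) => F (z.1.1, z.2.1) - G (z.1.2, z.2.2)) =ᵐ[ρ.prod ρ] 0 := by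
    refine ae_eq_zero_of_setIntegral_eq_zero_of_isPiSystem
      (generateFrom_eq_prod hRgen hRgen ⟨E, hER, hEU⟩ ⟨E, hER, hEU⟩).symm (hRpi.prod hRpi)
      (B := fun k => E k ×ˢ E k) (fun k => mem_image2_of_mem (hER k) (hER k))
      (fun i j hij => prod_mono (hEm hij) (hEm hij))
      (by rw [iUnion_prod_of_monotone hEm hEm, hEU, univ_prod_univ]) ((hFi ρ hρ₁).sub (hGi ρ hρ₂)) ?_
    rintro _ ⟨C, hC, D, hD, rfl⟩
    have h := (tendsto_setIntegral_prod_comp measurable_fst hσ₁ hρ₁ (hslice₁ C hC) (hslice₁ D hD)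
      hF).sub (tendsto_setIntegral_prod_comp measurable_snd hσ₂ hρ₂ (hslice₂ C hC) (hslice₂ D hD) hG)
    rw [← integral_sub (hFi ρ hρ₁).integrableOn (hGi ρ hρ₂).integrableOn] at h
    have h' := h.congr fun n => (integral_sub (hFi (σ n) (hσ₁ n)).integrableOn
      (hGi (σ n) (hσ₂ n)).integrableOn).symm
    exact tendsto_nhds_unique h' (squeeze_zero_norm (fun n => hcut n C D (hRm C hC) (hRm D hD)) hε)
  filter_upwards [key] with z hz
  exact sub_eq_zero.1 hz

/-- The part of `μ` that is lost in the limit does not interact with `F`. Here `φ` and `ψ` stand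
for the two projections, in any order. -/
theorem ae_eq_zero_of_tendsto_measureReal {X : Type*} [MeasurableSpace X] {φ : X → S} {ψ : X → T}
    (hφ : Measurable φ) (hψ : Measurable ψ) {μ : Measure S} {κ : Measure T} [SigmaFinite μ]
    [SigmaFinite κ] {l : Filter ι} [l.NeBot] {σ : ι → Measure X} {ρ : Measure X}
    (hσ₁ : ∀ n, (σ n).map φ = μ) (hσ₂ : ∀ n, (σ n).map ψ = κ) {τ : Measure S}
    (hτ : ρ.map φ + τ = μ)
    (hconv : ∀ s, MeasurableSet s → μ s < ∞ → ∀ t, MeasurableSet t → κ t < ∞ →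
      Tendsto (fun n => (σ n).real (φ ⁻¹' s ∩ ψ ⁻¹' t)) l (𝓝 (ρ.real (φ ⁻¹' s ∩ ψ ⁻¹' t))))
    {F : S × S → ℝ} {G : T × T → ℝ} (hF : Integrable F (μ.prod μ)) (hG : Integrable G (κ.prod κ))
    {ε : ι → ℝ} (hε : Tendsto ε l (𝓝 0))
    (hcut : ∀ n, ∀ C D : Set X, MeasurableSet C → MeasurableSet D →
      |∫ z in C ×ˢ D, (F (φ z.1, φ z.2) - G (ψ z.1, ψ z.2)) ∂((σ n).prod (σ n))| ≤ ε n) :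
    F =ᵐ[τ.prod μ] 0 := by
  have hρμ : ρ.map φ ≤ μ := hτ ▸ Measure.le_add_right le_rfl
  have hτμ : τ ≤ μ := hτ ▸ Measure.le_add_left le_rfl
  have : SigmaFinite τ := Measure.sigmaFinite_of_le μ hτμ
  have hσs : ∀ n, SigmaFinite (σ n) := fun n => sigmaFinite_of_map_le hφ (hσ₁ n).le
  let B : ℕ → Set T := spanningSets κ
  have hB : ∀ k, MeasurableSet (B k) := measurableSet_spanningSets κ
  -- the mass which is lost or sits above the complement of `B k`
  let θ : ℕ → Measure S := fun k => (ρ.restrict (ψ ⁻¹' (B k))ᶜ).map φ + τ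
  have hθμ : ∀ k, θ k ≤ μ := fun k =>
    (add_le_add (Measure.map_mono Measure.restrict_le_self hφ) le_rfl).trans hτ.le
  have hρfin : ∀ s, MeasurableSet s → μ s < ∞ → ρ (φ ⁻¹' s) ≠ ∞ := fun s hs hsf => by
    rw [← Measure.map_apply hφ hs]
    exact ((hρμ s).trans_lt hsf).ne
  -- The right-hand side is the limit of `σ n (φ⁻¹ s ∩ (ψ⁻¹ B k)ᶜ)`, because `σ n` has marginal
  -- exactly `μ`. Thus `θ k` is the limit of the mass above the complement of `B k`.
  have hθ : ∀ k s, MeasurableSet s → μ s < ∞ →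
      (θ k).real s = μ.real s - ρ.real (φ ⁻¹' s ∩ ψ ⁻¹' (B k)) := by
    intro k s hs hsf
    have h1 : (θ k).real s = ρ.real (φ ⁻¹' s ∩ (ψ ⁻¹' (B k))ᶜ) + τ.real s := by
      rw [← map_restrict_real_apply hφ ρ _ hs]
      exact measureReal_add_apply
        (((map_restrict_le hφ hρμ _) s).trans_lt hsf).ne ((hτμ s).trans_lt hsf).ne
    have h2 : μ.real s = ρ.real (φ ⁻¹' s) + τ.real s := by
      rw [← map_measureReal_apply hφ hs, ← hτ]
      exact measureReal_add_apply ((hρμ s).trans_lt hsf).ne ((hτμ s).trans_lt hsf).ne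
    have h3 := measureReal_inter_add_sdiff (μ := ρ) (s := φ ⁻¹' s) (hψ (hB k)) (hρfin s hs hsf)
    rw [Set.sdiff_eq] at h3
    linarith
  have hrect : ∀ A D, MeasurableSet A → MeasurableSet D →
      ∫ w in A ×ˢ D, F w ∂(τ.prod μ) = 0 := by
    intro A D hA hD
    -- The tail of `G`, which bounds its contribution uniformly in `n` since every `σ n` has
    -- marginal `κ`.
    let η : ℕ → ℝ := fun k => ∫ w in (B k)ᶜ ×ˢ univ, ‖G w‖ ∂(κ.prod κ)
    have hη : Tendsto η atTop (𝓝 0) := by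
      have := tendsto_setIntegral_of_antitone (μ := κ.prod κ) (f := fun w => ‖G w‖)
        (s := fun k => (B k)ᶜ ×ˢ (univ : Set T)) (fun k => (hB k).compl.prod .univ)
        (fun i j hij => prod_mono_left (compl_subset_compl.2 (monotone_spanningSets κ hij)))
        ⟨0, hG.norm.integrableOn⟩
      have e : ⋂ k, (B k)ᶜ ×ˢ (univ : Set T) = ∅ := by
        refine eq_empty_of_forall_notMem fun w hw => ?_
        obtain ⟨k, hk⟩ := mem_iUnion.1 ((iUnion_spanningSets κ).symm ▸ mem_univ w.1)
        exact (mem_iInter.1 hw k).1 hk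
      rwa [e, setIntegral_empty] at this
    have hFσ := fun n => integrable_comp_prod hφ (hσ₁ n).le hF
    have hGσ := fun n => integrable_comp_prod hψ (hσ₂ n).le hG
    have hbound : ∀ k, |∫ w in A ×ˢ D, F w ∂((θ k).prod μ)| ≤ η k := by
      intro k
      let C : Set X := φ ⁻¹' A ∩ (ψ ⁻¹' (B k))ᶜ
      have hC : MeasurableSet C := (hφ hA).inter (hψ (hB k)).compl
      have hle : ∀ n, |∫ z in C ×ˢ (φ ⁻¹' D), F (φ z.1, φ z.2) ∂((σ n).prod (σ n))| ≤
          ε n + η k := by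
        intro n
        have h1 := hcut n C (φ ⁻¹' D) hC (hφ hD)
        rw [integral_sub (hFσ n).integrableOn (hGσ n).integrableOn] at h1
        have h2 : |∫ z in C ×ˢ (φ ⁻¹' D), G (ψ z.1, ψ z.2) ∂((σ n).prod (σ n))| ≤ η k := by
          rw [← Real.norm_eq_abs]
          refine (norm_integral_le_integral_norm _).trans ?_
          have h3 : η k = ∫ z in (ψ ⁻¹' (B k))ᶜ ×ˢ univ, ‖G (ψ z.1, ψ z.2)‖ ∂((σ n).prod (σ n)) := by
            rw [setIntegral_prod_comp hψ (hσ₂ n).le _ _ hG.norm.1, Measure.restrict_univ,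
              hσ₂ n, ← preimage_compl, ← Measure.restrict_map hψ (hB k).compl, hσ₂ n]
            change ∫ w in (B k)ᶜ ×ˢ univ, ‖G w‖ ∂(κ.prod κ) = _
            rw [← Measure.prod_restrict, Measure.restrict_univ]
          rw [h3]
          refine setIntegral_mono_set (hGσ n).norm.integrableOn
            (ae_of_all _ fun _ => norm_nonneg _) (LE.le.eventuallyLE ?_)
          exact prod_mono inter_subset_right (subset_univ _)
        have h3 := abs_le.1 h1
        have h4 := abs_le.1 h2
        exact abs_le.2 ⟨by linarith, by linarith⟩
      have hlim : Tendsto (fun n => ∫ z in C ×ˢ (φ ⁻¹' D), F (φ z.1, φ z.2) ∂((σ n).prod (σ n))) l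
          (𝓝 (∫ w in A ×ˢ D, F w ∂((θ k).prod μ))) := by
        have : SigmaFinite (θ k) := Measure.sigmaFinite_of_le μ (hθμ k)
        rw [← Measure.prod_restrict]
        simp_rw [fun n => setIntegral_prod_comp hφ (hσ₁ n).le C (φ ⁻¹' D) hF.1]
        refine tendsto_integral_prod_of_tendsto_measureReal
          (fun n => map_restrict_le hφ (hσ₁ n).le _) (Measure.restrict_le_self.trans (hθμ k))
          (fun n => map_restrict_le hφ (hσ₁ n).le _) Measure.restrict_le_self ?_ ?_ hF
        · intro s hs hsf
          have hsf' : μ (s ∩ A) < ∞ := (measure_mono inter_subset_left).trans_lt hsf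
          rw [measureReal_restrict_apply hs, hθ k _ (hs.inter hA) hsf']
          refine ((hconv _ (hs.inter hA) hsf' _ (hB k)
            (measure_spanningSets_lt_top κ k)).const_sub _).congr fun n => ?_
          rw [map_restrict_real_apply hφ _ _ hs]
          have h1 : (σ n).real (φ ⁻¹' (s ∩ A)) = μ.real (s ∩ A) := by
            rw [← map_measureReal_apply hφ (hs.inter hA), hσ₁ n]
          have h2 := measureReal_inter_add_sdiff (μ := σ n) (s := φ ⁻¹' (s ∩ A)) (hψ (hB k)) (by
            rw [← Measure.map_apply hφ (hs.inter hA), hσ₁ n]; exact hsf'.ne)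
          rw [Set.sdiff_eq, h1] at h2
          rw [← inter_assoc, ← preimage_inter]
          linarith
        -- The second factor is the full preimage of `D`, so its image is `μ.restrict D` for every
        -- `n` and nothing is lost there.
        · intro s hs hsf
          refine tendsto_const_nhds.congr fun n => ?_
          rw [← Measure.restrict_map hφ hD, hσ₁ n]
      have := le_of_tendsto_of_tendsto' hlim.abs (hε.add_const (η k)) hle
      rwa [zero_add] at this
    -- As `B k` exhausts `T`, the part of `θ k` coming from `ρ` disappears and only `τ` remains.
    have hlim : Tendsto (fun k => ∫ w in A ×ˢ D, F w ∂((θ k).prod μ)) atTop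
        (𝓝 (∫ w in A ×ˢ D, F w ∂(τ.prod μ))) := by
      have : ∀ k, SigmaFinite (θ k) := fun k => Measure.sigmaFinite_of_le μ (hθμ k)
      simp_rw [← Measure.prod_restrict]
      refine tendsto_integral_prod_of_tendsto_measureReal
          (fun k => Measure.restrict_le_self.trans (hθμ k)) (Measure.restrict_le_self.trans hτμ)
          (fun n => Measure.restrict_le_self) Measure.restrict_le_self ?_
          (fun s _ _ => tendsto_const_nhds) hF
      intro s hs hsf
      simp_rw [fun k => measureReal_restrict_apply (μ := θ k) (s := A) hs]
      rw [measureReal_restrict_apply hs]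
      have hsA := hs.inter hA
      have hsf' : μ (s ∩ A) < ∞ := (measure_mono inter_subset_left).trans_lt hsf
      have h1 : Tendsto (fun k => ρ.real (φ ⁻¹' (s ∩ A) ∩ ψ ⁻¹' (B k))) atTop
          (𝓝 (ρ.real (φ ⁻¹' (s ∩ A)))) := by
        have := tendsto_measure_iUnion_atTop (μ := ρ)
          (s := fun k => φ ⁻¹' (s ∩ A) ∩ ψ ⁻¹' (B k)) (fun i j hij =>
            inter_subset_inter_right _ (preimage_mono (monotone_spanningSets κ hij)))
        rw [← inter_iUnion, ← preimage_iUnion, iUnion_spanningSets, preimage_univ,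
          inter_univ] at this
        exact (ENNReal.tendsto_toReal (hρfin _ hsA hsf')).comp this
      have h2 : τ.real (s ∩ A) = μ.real (s ∩ A) - ρ.real (φ ⁻¹' (s ∩ A)) := by
        rw [← map_measureReal_apply hφ hsA, ← hτ, measureReal_add_apply
          ((hρμ _).trans_lt hsf').ne ((hτμ _).trans_lt hsf').ne]
        ring
      rw [h2]
      exact (h1.const_sub _).congr fun k => (hθ k _ hsA hsf').symm
    exact tendsto_nhds_unique hlim (squeeze_zero_norm hbound hη)
  refine ae_eq_zero_of_setIntegral_eq_zero_of_isPiSystem generateFrom_prod.symm isPiSystem_prod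
    (B := fun _ => univ) (fun _ => ⟨univ, .univ, univ, .univ, univ_prod_univ⟩)
    monotone_const (iUnion_const _) (hF.mono_measure (Measure.prod_mono hτμ le_rfl)) ?_
  rintro _ ⟨A, hA, D, hD, rfl⟩
  exact hrect A D hA hD

end LimitCoupling

/-! ### Disjoint unions of standard Borel spaces. -/

section SumSpace

variable {S T : Type*} [MeasurableSpace S] [MeasurableSpace T]

theorem measurableEmbedding_inl : MeasurableEmbedding (Sum.inl : S → S ⊕ T) :=
  ⟨Sum.inl_injective, measurable_inl, fun _ hs => measurableSet_inl_image.2 hs⟩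

theorem measurableEmbedding_inr : MeasurableEmbedding (Sum.inr : T → S ⊕ T) :=
  ⟨Sum.inr_injective, measurable_inr, fun _ hs => measurableSet_inr_image.2 hs⟩

theorem standardBorelSpace_of_measurableEmbedding [StandardBorelSpace T] {e : S → T}
    (he : MeasurableEmbedding e) : StandardBorelSpace S := by
  have := he.measurableSet_range.standardBorel
  obtain ⟨t, ht, _⟩ := this.polish
  let q : S ≃ᵐ range e := he.equivRange
  refine ⟨t.induced q, @BorelSpace.mk _ (_) _ ?_, q.toEquiv.polishSpace_induced⟩
  rw [borel_comap, ← ht.measurable_eq]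
  exact q.measurableEmbedding.comap_eq.symm

instance standardBorelSpace_sum [StandardBorelSpace S] [StandardBorelSpace T] :
    StandardBorelSpace (S ⊕ T) := by
  -- The Boolean tag keeps the two images in `ℝ` disjoint.
  let e : S ⊕ T → (Bool × ℝ) :=
    Sum.elim (fun x => (true, embeddingReal S x)) (fun y => (false, embeddingReal T y))
  have h₁ : MeasurableEmbedding fun x : S => (true, embeddingReal S x) :=
    (measurable_const.prodMk (measurable_embeddingReal S)).measurableEmbedding
      fun x y h => (measurableEmbedding_embeddingReal S).injective (Prod.ext_iff.1 h).2
  have h₂ : MeasurableEmbedding fun y : T => (false, embeddingReal T y) :=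
    (measurable_const.prodMk (measurable_embeddingReal T)).measurableEmbedding
      fun x y h => (measurableEmbedding_embeddingReal T).injective (Prod.ext_iff.1 h).2
  have he : MeasurableEmbedding e := by
    refine ⟨?_, measurable_fun_sum h₁.measurable h₂.measurable, fun {s} hs => ?_⟩
    · refine Function.Injective.sumElim h₁.injective h₂.injective fun x y h => ?_
      simpa using (Prod.ext_iff.1 h).1
    · have : e '' s = (fun x : S => (true, embeddingReal S x)) '' (Sum.inl ⁻¹' s) ∪
          (fun y : T => (false, embeddingReal T y)) '' (Sum.inr ⁻¹' s) := by
        ext w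
        constructor
        · rintro ⟨x | y, hz, rfl⟩
          · exact Or.inl ⟨x, hz, rfl⟩
          · exact Or.inr ⟨y, hz, rfl⟩
        · rintro (⟨x, hx, rfl⟩ | ⟨y, hy, rfl⟩)
          · exact ⟨Sum.inl x, hx, rfl⟩
          · exact ⟨Sum.inr y, hy, rfl⟩
      rw [this]
      exact (h₁.measurableSet_image.2 (measurable_inl hs)).union
        (h₂.measurableSet_image.2 (measurable_inr hs))
  exact standardBorelSpace_of_measurableEmbedding he

end SumSpace

/-! ### Trivial extensions by a real line, and their composition. -/

section Extensions

variable {S T U : Type*} [MeasurableSpace S] [MeasurableSpace T] [MeasurableSpace U]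

/-- The measure on the line is left free: it is Lebesgue measure in the definition of `cutDist`, and
a copy of the other space's lost mass in the final coupling. -/
theorem isTrivialExtension_extFun {μ : Measure S} {W : S → S → ℝ} (hW : IsGraphon μ W)
    (τ : Measure ℝ) [SigmaFinite τ] :
    IsTrivialExtension μ W (μ.map Sum.inl + τ.map Sum.inr) (extFun W) Sum.inl where
  isGraphon :=
    { sigmaFinite := by
        have := hW.sigmaFinite
        have := (measurableEmbedding_inl (S := S) (T := ℝ)).sigmaFinite_map (μ := μ)
        have := (measurableEmbedding_inr (S := S) (T := ℝ)).sigmaFinite_map (μ := τ)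
        infer_instance
      symm := by
        rintro (x | x) (y | y)
        · exact hW.symm x y
        all_goals rfl
      integrable := by
        have := hW.sigmaFinite
        have i₁ := measurableEmbedding_inl (S := S) (T := ℝ)
        have i₂ := measurableEmbedding_inr (S := S) (T := ℝ)
        have := i₁.sigmaFinite_map (μ := μ)
        have := i₂.sigmaFinite_map (μ := τ)
        rw [Measure.prod_add, Measure.add_prod, Measure.add_prod,
          Measure.map_prod_map _ _ i₁.measurable i₁.measurable,
          Measure.map_prod_map _ _ i₁.measurable i₂.measurable,
          Measure.map_prod_map _ _ i₂.measurable i₁.measurable,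
          Measure.map_prod_map _ _ i₂.measurable i₂.measurable]
        refine ((((i₁.prodMap i₁).integrable_map_iff).2 ?_).add_measure
          (((i₂.prodMap i₁).integrable_map_iff).2 ?_)).add_measure
          ((((i₁.prodMap i₂).integrable_map_iff).2 ?_).add_measure
          (((i₂.prodMap i₂).integrable_map_iff).2 ?_))
        · exact hW.integrable
        all_goals exact integrable_zero _ _ _ }
  measurableEmbedding := measurableEmbedding_inl
  comap_eq := by
    ext s _
    have h : (Sum.inr ⁻¹' (Sum.inl '' s) : Set ℝ) = ∅ := by ext; simp
    rw [measurableEmbedding_inl.comap_apply, Measure.add_apply, measurableEmbedding_inl.map_apply,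
      measurableEmbedding_inr.map_apply, Sum.inl_injective.preimage_image, h, measure_empty,
      add_zero]
  apply_apply _ _ := rfl
  eq_zero := by
    rintro (x | x) (y | y) h
    · simp at h
    all_goals rfl

theorem IsTrivialExtension.trans {μ : Measure S} {W : S → S → ℝ} {ν : Measure T} {V : T → T → ℝ}
    {ι : S → T} {η : Measure U} {Y : U → U → ℝ} {κ : T → U} (h : IsTrivialExtension μ W ν V ι)
    (h' : IsTrivialExtension ν V η Y κ) : IsTrivialExtension μ W η Y (κ ∘ ι) where
  isGraphon := h'.isGraphon
  measurableEmbedding := h'.measurableEmbedding.comp h.measurableEmbedding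
  comap_eq := by
    rw [← h.comap_eq, ← h'.comap_eq, Measure.comap_comap
      (fun s hs => h.measurableEmbedding.measurableSet_image.2 hs)
      h'.measurableEmbedding.injective
      (fun s hs => h'.measurableEmbedding.measurableSet_image.2 hs)]
  apply_apply x y := by rw [Function.comp_apply, Function.comp_apply, h'.apply_apply, h.apply_apply]
  eq_zero a b hab := by
    by_cases ha : a ∈ range κ
    · by_cases hb : b ∈ range κ
      · obtain ⟨a, rfl⟩ := ha
        obtain ⟨b, rfl⟩ := hb
        rw [h'.apply_apply]
        refine h.eq_zero a b (hab.imp (fun k hk => k ?_) (fun k hk => k ?_))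
        · obtain ⟨x, rfl⟩ := hk
          exact ⟨x, rfl⟩
        · obtain ⟨x, rfl⟩ := hk
          exact ⟨x, rfl⟩
      · exact h'.eq_zero a b (Or.inr hb)
    · exact h'.eq_zero a b (Or.inl ha)

end Extensions

/-! ### From the limiting sub-coupling to a coupling of extensions. -/

section Coupling

/-- The density of `ρ` is at most 1, so its complement to 1 is the density of the difference; total
masses may be infinite. -/
theorem exists_add_eq_of_le {S : Type*} [MeasurableSpace S] {ρ μ : Measure S} [SigmaFinite μ]
    (h : ρ ≤ μ) : ∃ τ, ρ + τ = μ := by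
  have : SigmaFinite ρ := Measure.sigmaFinite_of_le μ h
  refine ⟨μ.withDensity fun x => 1 - ρ.rnDeriv μ x, ?_⟩
  nth_rewrite 1 [← Measure.withDensity_rnDeriv_eq ρ μ (Measure.absolutelyContinuous_of_le h)]
  rw [← withDensity_add_left (Measure.measurable_rnDeriv ρ μ)]
  nth_rewrite 4 [← withDensity_one (μ := μ)]
  refine withDensity_congr_ae ?_
  filter_upwards [Measure.rnDeriv_le_one_of_le h] with x hx
  exact add_tsub_cancel_of_le hx

theorem abs_setIntegral_le_of_cutNorm_le {S : Type*} [MeasurableSpace S] {μ : Measure S}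
    {F : S → S → ℝ} {ε : ℝ} (hε : 0 ≤ ε) (h : cutNorm μ F ≤ ENNReal.ofReal ε) {A B : Set S}
    (hA : MeasurableSet A) (hB : MeasurableSet B) :
    |∫ z in A ×ˢ B, F z.1 z.2 ∂(μ.prod μ)| ≤ ε := by
  have h1 : ‖∫ z in A ×ˢ B, F z.1 z.2 ∂(μ.prod μ)‖ₑ ≤ cutNorm μ F :=
    le_iSup₂_of_le A hA (le_iSup₂_of_le B hB le_rfl)
  have h2 := h1.trans h
  rwa [← ofReal_norm, ENNReal.ofReal_le_ofReal_iff hε, Real.norm_eq_abs] at h2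

theorem ae_prod_map_of_measurableEmbedding {X Y S T : Type*} [MeasurableSpace X]
    [MeasurableSpace Y] [MeasurableSpace S] [MeasurableSpace T] {α : Measure X} {β : Measure Y}
    [SFinite α] [SFinite β] {f : X → S} {g : Y → T} (hf : MeasurableEmbedding f)
    (hg : MeasurableEmbedding g) {p : S × T → Prop}
    (h : ∀ᵐ z ∂(α.prod β), p (f z.1, g z.2)) : ∀ᵐ z ∂((α.map f).prod (β.map g)), p z := by
  rw [Measure.map_prod_map _ _ hf.measurable hg.measurable, (hf.prodMap hg).ae_map_iff]
  exact h

theorem ae_prod_comp_snd_eq_zero {X S : Type*} [MeasurableSpace X] [MeasurableSpace S]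
    {τ μ : Measure S} [SigmaFinite μ] [SigmaFinite τ] {ρ : Measure X} [SigmaFinite ρ] {f : X → S}
    (hf : Measurable f) (hρ : ρ.map f ≤ μ) {W : S → S → ℝ}
    (h : ∀ᵐ z ∂(τ.prod μ), W z.1 z.2 = 0) : ∀ᵐ z ∂(τ.prod ρ), W z.1 (f z.2) = 0 := by
  have : SigmaFinite (ρ.map f) := Measure.sigmaFinite_of_le μ hρ
  have h1 : ∀ᵐ z ∂((τ.map id).prod (ρ.map f)), W z.1 z.2 = 0 := by
    rw [Measure.map_id]
    exact ae_mono (Measure.prod_mono le_rfl hρ) h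
  rw [Measure.map_prod_map _ _ measurable_id hf] at h1
  exact ae_of_ae_map (measurable_id.prodMap hf).aemeasurable h1

theorem ae_prod_comp_fst_eq_zero {X S : Type*} [MeasurableSpace X] [MeasurableSpace S]
    {τ μ : Measure S} [SigmaFinite μ] [SigmaFinite τ] {ρ : Measure X} [SigmaFinite ρ] {f : X → S}
    (hf : Measurable f) (hρ : ρ.map f ≤ μ) {W : S → S → ℝ} (hW : ∀ x y, W x y = W y x)
    (h : ∀ᵐ z ∂(τ.prod μ), W z.1 z.2 = 0) : ∀ᵐ z ∂(ρ.prod τ), W (f z.1) z.2 = 0 := by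
  have h1 := ae_prod_comp_snd_eq_zero hf hρ h
  rw [← Measure.prod_swap] at h1
  filter_upwards [ae_of_ae_map measurable_swap.aemeasurable h1] with z hz
  rw [hW]
  exact hz

variable {S₁ S₂ : Type*} [MeasurableSpace S₁] [MeasurableSpace S₂] [StandardBorelSpace S₁]
  [StandardBorelSpace S₂]

/-- If the infimum over couplings vanishes, then there is a sub-coupling along which the two
graphons agree, and the uncoupled mass does not interact with the graphons. -/
theorem exists_subcoupling_of_couplingCutDist_eq_zero {μ₁ : Measure S₁} {μ₂ : Measure S₂}
    {W₁ : S₁ → S₁ → ℝ} {W₂ : S₂ → S₂ → ℝ} (hW₁ : IsGraphon μ₁ W₁) (hW₂ : IsGraphon μ₂ W₂)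
    (h : couplingCutDist μ₁ μ₂ W₁ W₂ = 0) :
    ∃ (ρ : Measure (S₁ × S₂)) (τ₁ : Measure S₁) (τ₂ : Measure S₂),
      ρ.map Prod.fst + τ₁ = μ₁ ∧ ρ.map Prod.snd + τ₂ = μ₂ ∧
      (∀ᵐ z ∂(ρ.prod ρ), W₁ z.1.1 z.2.1 = W₂ z.1.2 z.2.2) ∧
      (∀ᵐ z ∂(τ₁.prod μ₁), W₁ z.1 z.2 = 0) ∧ (∀ᵐ z ∂(τ₂.prod μ₂), W₂ z.1 z.2 = 0) := by
  have := hW₁.sigmaFinite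
  have := hW₂.sigmaFinite
  have hex : ∀ n : ℕ, ∃ σ : Measure (S₁ × S₂), IsCoupling σ μ₁ μ₂ Prod.fst Prod.snd ∧
      cutNorm σ (pullback Prod.fst W₁ - pullback Prod.snd W₂) ≤ ENNReal.ofReal (1 / (n + 1)) := by
    intro n
    -- An infimum over no couplings would be `∞`, so the value 0 also yields that couplings exist.
    have hlt : couplingCutDist μ₁ μ₂ W₁ W₂ < ENNReal.ofReal (1 / (n + 1)) := by
      rw [h, ENNReal.ofReal_pos]
      positivity
    obtain ⟨σ, hσ⟩ := iInf_lt_iff.1 hlt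
    obtain ⟨hσ, hσn⟩ := iInf_lt_iff.1 hσ
    exact ⟨σ, hσ, hσn.le⟩
  choose σ hσ hcut using hex
  have hε : Tendsto (fun n : ℕ => 1 / ((n : ℝ) + 1)) (hyperfilter ℕ) (𝓝 0) :=
    tendsto_one_div_add_atTop_nhds_zero_nat.mono_left Nat.hyperfilter_le_atTop
  have hcut' : ∀ n, ∀ C D : Set (S₁ × S₂), MeasurableSet C → MeasurableSet D →
      |∫ z in C ×ˢ D, (W₁ z.1.1 z.2.1 - W₂ z.1.2 z.2.2) ∂((σ n).prod (σ n))| ≤ 1 / ((n : ℝ) + 1) :=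
    fun n C D hC hD => abs_setIntegral_le_of_cutNorm_le (by positivity) (hcut n) hC hD
  have hσ₁ := fun n => (hσ n).fst.map_eq
  have hσ₂ := fun n => (hσ n).snd.map_eq
  obtain ⟨ρ, hρ₁, hρ₂, hconv⟩ := exists_tendsto_measureReal_prod (hyperfilter ℕ)
    (fun n => (hσ₁ n).le) (fun n => (hσ₂ n).le)
  obtain ⟨τ₁, hτ₁⟩ := exists_add_eq_of_le hρ₁
  obtain ⟨τ₂, hτ₂⟩ := exists_add_eq_of_le hρ₂
  refine ⟨ρ, τ₁, τ₂, hτ₁, hτ₂, ?_, ?_, ?_⟩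
  · exact ae_eq_of_tendsto_measureReal_prod (fun n => (hσ₁ n).le) (fun n => (hσ₂ n).le) hρ₁ hρ₂ hconv
      hW₁.integrable hW₂.integrable hε hcut'
  · exact ae_eq_zero_of_tendsto_measureReal measurable_fst measurable_snd hσ₁ hσ₂ hτ₁ hconv
      hW₁.integrable hW₂.integrable hε hcut'
  · refine ae_eq_zero_of_tendsto_measureReal measurable_snd measurable_fst hσ₂ hσ₁ hτ₂
      (fun s hs hsf t ht htf => ?_) hW₂.integrable hW₁.integrable hε fun n C D hC hD => ?_
    · simp only [inter_comm (Prod.snd ⁻¹' s)]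
      exact hconv t ht htf s hs hsf
    · rw [← abs_neg, ← integral_neg]
      simpa only [neg_sub] using hcut' n C D hC hD

/-- The coupling is `ρ`, plus `τ₁` and `τ₂` carried by graphs of embeddings into the opposite lines.
Of the nine blocks of its square, the one for `ρ` with itself is agreement on the sub-coupling; in
every other block both sides vanish, because a line is involved or lost mass is. -/
theorem exists_coupling_of_couplingCutDist_eq_zero {μ₁ : Measure S₁} {μ₂ : Measure S₂}
    {W₁ : S₁ → S₁ → ℝ} {W₂ : S₂ → S₂ → ℝ} (hW₁ : IsGraphon μ₁ W₁) (hW₂ : IsGraphon μ₂ W₂)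
    (h : couplingCutDist μ₁ μ₂ W₁ W₂ = 0) :
    ∃ (ν₁ : Measure (S₁ ⊕ ℝ)) (ν₂ : Measure (S₂ ⊕ ℝ)) (ν : Measure ((S₁ ⊕ ℝ) × (S₂ ⊕ ℝ))),
      IsTrivialExtension μ₁ W₁ ν₁ (extFun W₁) Sum.inl ∧
      IsTrivialExtension μ₂ W₂ ν₂ (extFun W₂) Sum.inl ∧
      IsCoupling ν ν₁ ν₂ Prod.fst Prod.snd ∧
      ∀ᵐ z ∂(ν.prod ν), pullback Prod.fst (extFun W₁) z.1 z.2 =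
        pullback Prod.snd (extFun W₂) z.1 z.2 := by
  have := hW₁.sigmaFinite
  have := hW₂.sigmaFinite
  obtain ⟨ρ, τ₁, τ₂, hτ₁, hτ₂, hρρ, h₁, h₂⟩ :=
    exists_subcoupling_of_couplingCutDist_eq_zero hW₁ hW₂ h
  have hρ₁ : ρ.map Prod.fst ≤ μ₁ := hτ₁ ▸ Measure.le_add_right le_rfl
  have hρ₂ : ρ.map Prod.snd ≤ μ₂ := hτ₂ ▸ Measure.le_add_right le_rfl
  have hτμ₁ : τ₁ ≤ μ₁ := hτ₁ ▸ Measure.le_add_left le_rfl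
  have hτμ₂ : τ₂ ≤ μ₂ := hτ₂ ▸ Measure.le_add_left le_rfl
  have : SigmaFinite τ₁ := Measure.sigmaFinite_of_le μ₁ hτμ₁
  have : SigmaFinite τ₂ := Measure.sigmaFinite_of_le μ₂ hτμ₂
  have : SigmaFinite ρ := sigmaFinite_of_map_le measurable_fst hρ₁
  have he₁ := measurableEmbedding_embeddingReal S₁
  have he₂ := measurableEmbedding_embeddingReal S₂
  have := he₁.sigmaFinite_map (μ := τ₁)
  have := he₂.sigmaFinite_map (μ := τ₂)
  let f : S₁ × S₂ → (S₁ ⊕ ℝ) × (S₂ ⊕ ℝ) := Prod.map Sum.inl Sum.inl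
  let g₁ : S₁ → (S₁ ⊕ ℝ) × (S₂ ⊕ ℝ) := fun x => (Sum.inl x, Sum.inr (embeddingReal S₁ x))
  let g₂ : S₂ → (S₁ ⊕ ℝ) × (S₂ ⊕ ℝ) := fun y => (Sum.inr (embeddingReal S₂ y), Sum.inl y)
  have hf : MeasurableEmbedding f := measurableEmbedding_inl.prodMap measurableEmbedding_inl
  have hg₁ : MeasurableEmbedding g₁ :=
    (measurable_inl.prodMk (measurable_inr.comp he₁.measurable)).measurableEmbedding
      fun x y h => Sum.inl_injective (Prod.ext_iff.1 h).1
  have hg₂ : MeasurableEmbedding g₂ :=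
    ((measurable_inr.comp he₂.measurable).prodMk measurable_inl).measurableEmbedding
      fun x y h => Sum.inl_injective (Prod.ext_iff.1 h).2
  -- The line adjoined to `S₁` carries the mass lost by `S₂`, and conversely.
  refine ⟨μ₁.map Sum.inl + (τ₂.map (embeddingReal S₂)).map Sum.inr,
    μ₂.map Sum.inl + (τ₁.map (embeddingReal S₁)).map Sum.inr,
    ρ.map f + τ₁.map g₁ + τ₂.map g₂, isTrivialExtension_extFun hW₁ _,
    isTrivialExtension_extFun hW₂ _, ⟨⟨measurable_fst, ?_⟩, ⟨measurable_snd, ?_⟩⟩, ?_⟩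
  · rw [Measure.map_add _ _ measurable_fst, Measure.map_add _ _ measurable_fst,
      Measure.map_map measurable_fst hf.measurable, Measure.map_map measurable_fst hg₁.measurable,
      Measure.map_map measurable_fst hg₂.measurable, ← hτ₁, Measure.map_add _ _ measurable_inl,
      Measure.map_map measurable_inl measurable_fst, Measure.map_map measurable_inr he₂.measurable]
    rfl
  · rw [Measure.map_add _ _ measurable_snd, Measure.map_add _ _ measurable_snd,
      Measure.map_map measurable_snd hf.measurable, Measure.map_map measurable_snd hg₁.measurable,
      Measure.map_map measurable_snd hg₂.measurable, ← hτ₂, Measure.map_add _ _ measurable_inl,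
      Measure.map_map measurable_inl measurable_snd, Measure.map_map measurable_inr he₁.measurable,
      add_right_comm]
    rfl
  · simp only [Measure.prod_add, Measure.add_prod, ae_add_measure_iff]
    refine ⟨⟨⟨⟨?_, ?_⟩, ?_⟩, ⟨⟨?_, ?_⟩, ?_⟩⟩, ⟨⟨?_, ?_⟩, ?_⟩⟩
    · exact ae_prod_map_of_measurableEmbedding hf hf hρρ
    · exact ae_prod_map_of_measurableEmbedding hg₁ hf (ae_prod_comp_snd_eq_zero measurable_fst hρ₁ h₁)
    · refine ae_prod_map_of_measurableEmbedding hg₂ hf ?_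
      filter_upwards [ae_prod_comp_snd_eq_zero measurable_snd hρ₂ h₂] with z hz
      exact hz.symm
    · exact ae_prod_map_of_measurableEmbedding hf hg₁
        (ae_prod_comp_fst_eq_zero measurable_fst hρ₁ hW₁.symm h₁)
    · exact ae_prod_map_of_measurableEmbedding hg₁ hg₁ (ae_mono (Measure.prod_mono le_rfl hτμ₁) h₁)
    · exact ae_prod_map_of_measurableEmbedding hg₂ hg₁ (ae_of_all _ fun _ => rfl)
    · refine ae_prod_map_of_measurableEmbedding hf hg₂ ?_
      filter_upwards [ae_prod_comp_fst_eq_zero measurable_snd hρ₂ hW₂.symm h₂] with z hz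
      exact hz.symm
    · exact ae_prod_map_of_measurableEmbedding hg₁ hg₂ (ae_of_all _ fun _ => rfl)
    · refine ae_prod_map_of_measurableEmbedding hg₂ hg₂ ?_
      filter_upwards [ae_mono (Measure.prod_mono le_rfl hτμ₂) h₂] with z hz
      exact hz.symm

end Coupling

end SigmaFiniteGraphon

theorem theorem5p3 {S₁ : Type u} {S₂ : Type v} [MeasurableSpace S₁] [MeasurableSpace S₂]
    [StandardBorelSpace S₁] [StandardBorelSpace S₂] (μ₁ : Measure S₁) (μ₂ : Measure S₂)
    (W₁ : S₁ → S₁ → ℝ) (W₂ : S₂ → S₂ → ℝ)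
    (hW₁ : SigmaFiniteGraphon.IsGraphon μ₁ W₁) (hW₂ : SigmaFiniteGraphon.IsGraphon μ₂ W₂)
    (h : SigmaFiniteGraphon.cutDist μ₁ μ₂ W₁ W₂ = 0) :
    ∃ (T₁ : Type u) (_ : MeasurableSpace T₁) (ν₁ : Measure T₁) (V₁ : T₁ → T₁ → ℝ) (ι₁ : S₁ → T₁)
      (T₂ : Type v) (_ : MeasurableSpace T₂) (ν₂ : Measure T₂) (V₂ : T₂ → T₂ → ℝ) (ι₂ : S₂ → T₂)
      (ν : Measure (T₁ × T₂)),
      SigmaFiniteGraphon.IsTrivialExtension μ₁ W₁ ν₁ V₁ ι₁ ∧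
      SigmaFiniteGraphon.IsTrivialExtension μ₂ W₂ ν₂ V₂ ι₂ ∧
      SigmaFiniteGraphon.IsCoupling ν ν₁ ν₂ Prod.fst Prod.snd ∧
      ∀ᵐ z : (T₁ × T₂) × (T₁ × T₂) ∂(ν.prod ν),
        SigmaFiniteGraphon.pullback Prod.fst V₁ z.1 z.2 =
          SigmaFiniteGraphon.pullback Prod.snd V₂ z.1 z.2 := by
  unfold SigmaFiniteGraphon.cutDist at h
  split_ifs at h
  · obtain ⟨ν₁, ν₂, ν, h₁, h₂, hν, hae⟩ :=
      SigmaFiniteGraphon.exists_coupling_of_couplingCutDist_eq_zero hW₁ hW₂ h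
    exact ⟨S₁ ⊕ ℝ, _, ν₁, _, _, S₂ ⊕ ℝ, _, ν₂, _, _, ν, h₁, h₂, hν, hae⟩
  -- For unequal masses the hypothesis concerns the extensions by Lebesgue measure; extending these
  -- once more is still a trivial extension of the original graphons.
  · have e₁ := SigmaFiniteGraphon.isTrivialExtension_extFun hW₁ volume
    have e₂ := SigmaFiniteGraphon.isTrivialExtension_extFun hW₂ volume
    obtain ⟨ν₁, ν₂, ν, h₁, h₂, hν, hae⟩ :=
      SigmaFiniteGraphon.exists_coupling_of_couplingCutDist_eq_zero e₁.isGraphon e₂.isGraphon h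
    exact ⟨(S₁ ⊕ ℝ) ⊕ ℝ, _, ν₁, _, _, (S₂ ⊕ ℝ) ⊕ ℝ, _, ν₂, _, _, ν, e₁.trans h₁, e₂.trans h₂,
      hν, hae⟩
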